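/- Let $A$ be a nonzero unital $C^*$-algebra generated as a $C^*$-algebra by isometries $S_1,\dots,S_n$ ($S_i^*S_i=1$; for $n=0$ this means $A=\mathbb C1$), and let $\mathcal A\subset A$ be the dense unital $*$-subalgebra generated by the $S_i$. Suppose that there are $\mathbb C$-linear derivations $\partial_1,\dots,\partial_n:\mathcal A\to\mathcal A$ with $\partial_i(S_j)=\delta_{ij}S_j$ and $\partial_i(S_j^*)=-\delta_{ij}S_j^*$ for all $i,j$. **Definitions.** Let $\tau$ be a faithful state on $A$, let $N=2^{\lfloor n/2\rfloor}$, and let $\gamma_1,\dots,\gamma_n\in M_N(\mathbb C)$ satisfy $\gamma_i^2=1$ and $\gamma_i\gamma_j=-\gamma_j\gamma_i$ for $i\ne j$. Represent $\mathcal A$ on $\mathcal H=L^2(A,\tau)\otimes\mathbb C^N$ by $\pi(a)=a\otimes 1$, where $L^2(A,\tau)$ is the GNS space, and let $D=\sum_i\partial_i\otimes\gamma_i$ with domain $\mathcal A\otimes\mathbb C^N$. The commutators $[D,\pi(a)]$ extend to bounded operators. Let $(\Omega^\bullet(\mathcal A),\delta)$ be the reduced universal differential graded algebra of $\mathcal A$,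 let $\Pi(a_0\,\delta a_1\cdots\delta a_k)=\pi(a_0)[D,\pi(a_1)]\cdots[D,\pi(a_k)]$, and let $J_0^k=\{\omega\in\Omega^k(\mathcal A):\Pi(\omega)=0\}$, with $J_0^{-1}=0$. Connes' space of $k$-forms is $\Omega^k_D=\Pi(\Omega^k(\mathcal A))/\Pi(\delta J_0^{k-1})$. With the product $\wedge$ induced by the product of operators and $d[\Pi(\omega)]=[\Pi(\delta\omega)]$, the sum $\bigoplus_k\Omega^k_D$ is a differential graded algebra with degree-zero part $\mathcal A$, generated as a differential graded algebra by its elements of degree zero (a differential calculus on $\mathcal A$). Write $\Omega^k=\Omega^k_D$. A differential calculus $(\Omega,\wedge,d)$ on $\mathcal A$ is *tame*, with idempotent $P$, if * $\Omega^1$ is finitely generated and projective as a right $\mathcal A$-module; * $\wedge:\Omega^1\otimes_{\mathcal A}\Omega^1\to\Omega^2$ is surjective, and $P$ is an idempotent $\mathcal A$-bimodule endomorphism of $\Omega^1\otimes_{\mathcal A}\Omega^1$ with range $\ker\wedge$ (so $0\to\ker\wedge\to\Omega^1\otimes_{\mathcal A}\Omega^1\to\Omega^2\to0$ is split by $\ker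 P$); * the map $Z(\Omega^1)\otimes_{Z(\mathcal A)}\mathcal A\to\Omega^1$, $e\otimes a\mapsto ea$, is bijective, where $Z$ denotes centers; * $\sigma:=2P-1$ satisfies $\sigma(\omega\otimes\eta)=\eta\otimes\omega$ for all $\omega,\eta\in Z(\Omega^1)$. A *bilinear pseudo-Riemannian metric* on it is an $\mathcal A$-bimodule map $g:\Omega^1\otimes_{\mathcal A}\Omega^1\to\mathcal A$ with $g\circ\sigma=g$ such that $\omega\mapsto g(\omega\otimes\,\cdot\,)$ is an isomorphism of right $\mathcal A$-modules from $\Omega^1$ onto $\mathrm{Hom}_{\mathcal A}(\Omega^1,\mathcal A)$ (right $\mathcal A$-linear maps). **Theorem.** A faithful state $\tau$ and matrices $\gamma_i$ as above exist. For every choice of them, $1\otimes\gamma_i\in\Pi(\Omega^1(\mathcal A))$ for each $i$. Let $e_i\in\Omega^1$ be the class of $1\otimes\gamma_i$. There is an idempotent $P$ such that the calculus $(\bigoplus_k\Omega^k,\wedge,d)$ is tame with idempotent $P$, and the following hold. 1. $\Omega^1$ is free as a right $\mathcal A$-module with basis $e_1,\dots,e_n$. Moreover $ae_i=e_ia$ for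 all $a\in\mathcal A$, and $d(e_i)=0$ for all $i$. 2. $\Omega^2$ is free as a right $\mathcal A$-module with basis $\{e_i\wedge e_j\}_{1\le i<j\le n}$. 3. For all $a_1,\dots,a_n\in\mathcal A$, $$d\Big(\sum_{i=1}^n e_ia_i\Big)=\sum_{1\le p<q\le n}e_p\wedge e_q\Big(\sum_{i=1}^n\big(\partial_p(a_iS_i^*)\,\partial_q(S_i)-\partial_q(a_iS_i^*)\,\partial_p(S_i)\big)\Big).$$ 4. There is a bilinear pseudo-Riemannian metric $g_0$ (with respect to $\sigma=2P-1$) with $g_0(e_i\otimes e_j)=\delta_{ij}$ for all $i,j$. -/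

import Mathlib

open scoped TensorProduct DirectSum ComplexOrder MulOpposite

noncomputable section

universe u v w

/-! ### The reduced universal differential graded algebra of an algebra -/

section Universal

variable (B : Type u) [Ring B] [Algebra ℂ B]

/-- The relations of the universal differential algebra. The generator `Sum.inl a` stands for `a`
and the generator `Sum.inr a` for `δ a`. -/
inductive UniversalRel : FreeAlgebra ℂ (B ⊕ B) → FreeAlgebra ℂ (B ⊕ B) → Prop
  | scalar (c : ℂ) : UniversalRel (FreeAlgebra.ι ℂ (Sum.inl (algebraMap ℂ B c)))
      (algebraMap ℂ _ c)
  | add (a b : B) : UniversalRel (FreeAlgebra.ι ℂ (Sum.inl (a + b)))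
      (FreeAlgebra.ι ℂ (Sum.inl a) + FreeAlgebra.ι ℂ (Sum.inl b))
  | mul (a b : B) : UniversalRel (FreeAlgebra.ι ℂ (Sum.inl (a * b)))
      (FreeAlgebra.ι ℂ (Sum.inl a) * FreeAlgebra.ι ℂ (Sum.inl b))
  | delta_smul (c : ℂ) (a : B) : UniversalRel (FreeAlgebra.ι ℂ (Sum.inr (c • a)))
      (c • FreeAlgebra.ι ℂ (Sum.inr a))
  | delta_add (a b : B) : UniversalRel (FreeAlgebra.ι ℂ (Sum.inr (a + b)))
      (FreeAlgebra.ι ℂ (Sum.inr a) + FreeAlgebra.ι ℂ (Sum.inr b))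
  | delta_mul (a b : B) : UniversalRel (FreeAlgebra.ι ℂ (Sum.inr (a * b)))
      (FreeAlgebra.ι ℂ (Sum.inr a) * FreeAlgebra.ι ℂ (Sum.inl b)
        + FreeAlgebra.ι ℂ (Sum.inl a) * FreeAlgebra.ι ℂ (Sum.inr b))

/-- The reduced universal differential graded algebra `Ω^•(B)`: the algebra generated by `B` and
symbols `δ a`, linear in `a`, with `δ (a b) = (δ a) b + a (δ b)`. -/
def UniversalForms : Type u := RingQuot (UniversalRel B)

instance : Ring (UniversalForms B) := inferInstanceAs (Ring (RingQuot (UniversalRel B)))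

instance : Algebra ℂ (UniversalForms B) :=
  inferInstanceAs (Algebra ℂ (RingQuot (UniversalRel B)))

namespace UniversalForms

/-- The quotient map from the free algebra. -/
def mk : FreeAlgebra ℂ (B ⊕ B) →ₐ[ℂ] UniversalForms B :=
  RingQuot.mkAlgHom ℂ (UniversalRel B)

variable {B} in
theorem mk_rel {x y : FreeAlgebra ℂ (B ⊕ B)} (h : UniversalRel B x y) : mk B x = mk B y :=
  RingQuot.mkAlgHom_rel ℂ h

/-- The inclusion of `B` as the elements of degree zero. -/
def incl : B →ₐ[ℂ] UniversalForms B :=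
  AlgHom.ofLinearMap
    { toFun := fun a => mk B (FreeAlgebra.ι ℂ (Sum.inl a))
      map_add' := fun a b => by
        rw [mk_rel (UniversalRel.add a b), map_add]
      map_smul' := fun c a => by
        rw [Algebra.smul_def, mk_rel (UniversalRel.mul _ _), map_mul,
          mk_rel (UniversalRel.scalar c), AlgHom.commutes,
          RingHom.id_apply, ← Algebra.smul_def] }
    (by
      have h := mk_rel (UniversalRel.scalar (B := B) 1)
      simpa using h)
    (fun a b => by
      change mk B (FreeAlgebra.ι ℂ (Sum.inl (a * b))) = _
      rw [mk_rel (UniversalRel.mul a b), map_mul]; rfl)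

/-- The symbol `δ a`. -/
def symb : B →ₗ[ℂ] UniversalForms B where
  toFun a := mk B (FreeAlgebra.ι ℂ (Sum.inr a))
  map_add' a b := by rw [mk_rel (UniversalRel.delta_add a b), map_add]
  map_smul' c a := by
    rw [mk_rel (UniversalRel.delta_smul c a), map_smul]; rfl

variable {B}

theorem symb_mul (a b : B) : symb B (a * b) = symb B a * incl B b + incl B a * symb B b := by
  change mk B (FreeAlgebra.ι ℂ (Sum.inr (a * b))) = _
  rw [mk_rel (UniversalRel.delta_mul a b), map_add, map_mul, map_mul]; rfl

/-- The universal property: a homomorphism `f` together with an `f`-derivation `g`. -/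
def lift {R : Type w} [Ring R] [Algebra ℂ R] (f : B →ₐ[ℂ] R) (g : B →ₗ[ℂ] R)
    (h : ∀ a b, g (a * b) = g a * f b + f a * g b) : UniversalForms B →ₐ[ℂ] R :=
  RingQuot.liftAlgHom ℂ ⟨FreeAlgebra.lift ℂ (Sum.elim f g), by
    intro x y hxy
    induction hxy <;> simp [h]⟩

section
variable {R : Type w} [Ring R] [Algebra ℂ R] (f : B →ₐ[ℂ] R) (g : B →ₗ[ℂ] R)
    (h : ∀ a b, g (a * b) = g a * f b + f a * g b)

@[simp] theorem lift_incl (a : B) : lift f g h (incl B a) = f a := by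
  change RingQuot.liftAlgHom ℂ _ (RingQuot.mkAlgHom ℂ (UniversalRel B) _) = _
  rw [RingQuot.liftAlgHom_mkAlgHom_apply]; simp

@[simp] theorem lift_symb (a : B) : lift f g h (symb B a) = g a := by
  change RingQuot.liftAlgHom ℂ _ (RingQuot.mkAlgHom ℂ (UniversalRel B) _) = _
  rw [RingQuot.liftAlgHom_mkAlgHom_apply]; simp

end

variable (B)

/-- The homomorphism `ω ↦ !![ω̂, δ ω; 0, ω]`, where `ω̂ = (-1)^k ω` in degree `k`. Multiplicativity
of this map is the graded Leibniz rule for `δ`. -/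
def triangular : UniversalForms B →ₐ[ℂ] Matrix (Fin 2) (Fin 2) (UniversalForms B) :=
  lift
    (AlgHom.ofLinearMap
      { toFun := fun a => !![incl B a, symb B a; 0, incl B a]
        map_add' := fun a b => by ext i j; fin_cases i <;> fin_cases j <;> simp
        map_smul' := fun c a => by ext i j; fin_cases i <;> fin_cases j <;> simp }
      (by
        have h : symb B 1 = 0 := by simpa using symb_mul (1 : B) 1
        ext i j; fin_cases i <;> fin_cases j <;> simp [h])
      (fun a b => by
        ext i j; fin_cases i <;> fin_cases j <;> simp [Matrix.mul_apply, symb_mul, add_comm]))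
    { toFun := fun a => !![-symb B a, 0; 0, symb B a]
      map_add' := fun a b => by
        ext i j; fin_cases i <;> fin_cases j <;> simp [add_comm]
      map_smul' := fun c a => by ext i j; fin_cases i <;> fin_cases j <;> simp }
    (fun a b => by
      ext i j; fin_cases i <;> fin_cases j <;>
        simp [symb_mul, add_comm])

/-- The universal differential `δ (a₀ δ a₁ ⋯ δ aₖ) = δ a₀ δ a₁ ⋯ δ aₖ`. -/
def delta : UniversalForms B →ₗ[ℂ] UniversalForms B where
  toFun ω := triangular B ω 0 1
  map_add' := by simp
  map_smul' := by simp

/-- The forms of degree `k`: the span of the products `a₀ δ a₁ ⋯ δ aₖ`. -/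
def grade (k : ℕ) : Submodule ℂ (UniversalForms B) :=
  LinearMap.range (incl B).toLinearMap * LinearMap.range (symb B) ^ k

variable {B}

theorem triangular_incl (a : B) : triangular B (incl B a) = !![incl B a, symb B a; 0, incl B a] := by
  simp [triangular]

theorem triangular_symb (a : B) : triangular B (symb B a) = !![-symb B a, 0; 0, symb B a] := by
  simp [triangular]

@[simp] theorem delta_incl (a : B) : delta B (incl B a) = symb B a := by
  simp [delta, triangular_incl]

@[simp] theorem delta_symb (a : B) : delta B (symb B a) = 0 := by
  simp [delta, triangular_symb]

/-- The elements on which the diagonal entries of `triangular` are as expected in degree `k`. -/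
def parity (B : Type u) [Ring B] [Algebra ℂ B] (k : ℕ) : Submodule ℂ (UniversalForms B) where
  carrier := {ω | triangular B ω 0 0 = (-1) ^ k * ω ∧ triangular B ω 1 0 = 0 ∧
    triangular B ω 1 1 = ω}
  add_mem' := by
    rintro x y ⟨h1, h2, h3⟩ ⟨h4, h5, h6⟩
    simp [h1, h2, h3, h4, h5, h6, mul_add]
  zero_mem' := by simp
  smul_mem' := by
    rintro c x ⟨h1, h2, h3⟩
    simp [h1, h2, h3]

theorem parity_mul {k l : ℕ} {x y : UniversalForms B} (hx : x ∈ parity B k)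
    (hy : y ∈ parity B l) : x * y ∈ parity B (k + l) := by
  obtain ⟨h1, h2, h3⟩ := hx
  obtain ⟨h4, h5, h6⟩ := hy
  refine ⟨?_, ?_, ?_⟩
  · have hc : x * (-1) ^ l = (-1) ^ l * x := ((Commute.neg_one_left x).pow_left l).eq.symm
    simp only [map_mul, Matrix.mul_apply, Fin.sum_univ_two, h1, h4, h5, mul_zero, add_zero, pow_add]
    rw [mul_assoc, ← mul_assoc x, hc]
    simp only [mul_assoc]
  · simp [Matrix.mul_apply, h2, h5]
  · simp [Matrix.mul_apply, h2, h3, h6]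

theorem delta_mul {k : ℕ} {x : UniversalForms B} (hx : x ∈ parity B k) {l : ℕ}
    {y : UniversalForms B} (hy : y ∈ parity B l) :
    delta B (x * y) = delta B x * y + (-1) ^ k * (x * delta B y) := by
  obtain ⟨h1, h2, h3⟩ := hx
  obtain ⟨h4, h5, h6⟩ := hy
  change triangular B (x * y) 0 1 = _
  rw [map_mul, Matrix.mul_apply, Fin.sum_univ_two, h1, h6, add_comm, mul_assoc]
  rfl

theorem incl_mem_parity (a : B) : incl B a ∈ parity B 0 := by
  simp [parity, triangular_incl]

theorem symb_mem_parity (a : B) : symb B a ∈ parity B 1 := by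
  simp [parity, triangular_symb]

theorem symb_pow_parity (k : ℕ) {x : UniversalForms B}
    (hx : x ∈ LinearMap.range (symb B) ^ k) : x ∈ parity B k ∧ delta B x = 0 := by
  induction k generalizing x with
  | zero =>
    rw [pow_zero, Submodule.mem_one] at hx
    obtain ⟨c, rfl⟩ := hx
    rw [← AlgHom.commutes (incl B) c]
    refine ⟨incl_mem_parity _, ?_⟩
    have h : symb B 1 = 0 := by simpa using symb_mul (1 : B) 1
    rw [delta_incl, Algebra.algebraMap_eq_smul_one, map_smul, h, smul_zero]
  | succ k ih =>
    rw [pow_succ] at hx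
    refine Submodule.mul_induction_on hx ?_ ?_
    · rintro m hm _ ⟨a, rfl⟩
      obtain ⟨h1, h2⟩ := ih hm
      refine ⟨parity_mul h1 (symb_mem_parity a), ?_⟩
      rw [delta_mul h1 (symb_mem_parity a), h2]; simp
    · rintro x y ⟨h1, h2⟩ ⟨h3, h4⟩
      exact ⟨add_mem h1 h3, by rw [map_add, h2, h4, add_zero]⟩

theorem grade_le_parity (k : ℕ) : grade B k ≤ parity B k := by
  refine Submodule.mul_le.2 ?_
  rintro _ ⟨a, rfl⟩ y hy
  simpa using parity_mul (incl_mem_parity a) (symb_pow_parity k hy).1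

theorem incl_mem_grade (a : B) : incl B a ∈ grade B 0 := by
  simp [grade]

theorem symb_mem_grade (a : B) : symb B a ∈ grade B 1 := by
  have := Submodule.mul_mem_mul (LinearMap.mem_range_self (incl B).toLinearMap 1)
    (LinearMap.mem_range_self (symb B) a)
  simpa [grade] using this

theorem symb_pow_mul_incl (k : ℕ) :
    LinearMap.range (symb B) ^ k * LinearMap.range (incl B).toLinearMap ≤ grade B k := by
  induction k with
  | zero => simp [grade]
  | succ k ih =>
    have hA : LinearMap.range (incl B).toLinearMap * LinearMap.range (incl B).toLinearMap ≤
        LinearMap.range (incl B).toLinearMap := by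
      refine Submodule.mul_le.2 ?_
      rintro _ ⟨a, rfl⟩ _ ⟨b, rfl⟩
      exact ⟨a * b, by simp⟩
    have h1 : LinearMap.range (symb B) * LinearMap.range (incl B).toLinearMap ≤
        LinearMap.range (incl B).toLinearMap * LinearMap.range (symb B) := by
      refine Submodule.mul_le.2 ?_
      rintro _ ⟨a, rfl⟩ _ ⟨b, rfl⟩
      have : symb B a * incl B b = incl B 1 * symb B (a * b) - incl B a * symb B b := by
        rw [symb_mul]; simp
      change symb B a * incl B b ∈ _
      rw [this]
      exact sub_mem (Submodule.mul_mem_mul ⟨1, rfl⟩ ⟨_, rfl⟩)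
        (Submodule.mul_mem_mul ⟨a, rfl⟩ ⟨_, rfl⟩)
    calc LinearMap.range (symb B) ^ (k + 1) * LinearMap.range (incl B).toLinearMap
        = LinearMap.range (symb B) ^ k *
          (LinearMap.range (symb B) * LinearMap.range (incl B).toLinearMap) := by
          rw [pow_succ, mul_assoc]
      _ ≤ LinearMap.range (symb B) ^ k *
          (LinearMap.range (incl B).toLinearMap * LinearMap.range (symb B)) :=
          mul_le_mul' le_rfl h1
      _ = (LinearMap.range (symb B) ^ k * LinearMap.range (incl B).toLinearMap) *
          LinearMap.range (symb B) := by rw [mul_assoc]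
      _ ≤ grade B k * LinearMap.range (symb B) := mul_le_mul' ih le_rfl
      _ = grade B (k + 1) := by rw [grade, grade, mul_assoc, pow_succ]

theorem grade_mul (k l : ℕ) : grade B k * grade B l ≤ grade B (k + l) := by
  have hA : LinearMap.range (incl B).toLinearMap * LinearMap.range (incl B).toLinearMap ≤
      LinearMap.range (incl B).toLinearMap := by
    refine Submodule.mul_le.2 ?_
    rintro _ ⟨a, rfl⟩ _ ⟨b, rfl⟩
    exact ⟨a * b, by simp⟩
  calc grade B k * grade B l
      = LinearMap.range (incl B).toLinearMap *
        (LinearMap.range (symb B) ^ k * LinearMap.range (incl B).toLinearMap) *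
        LinearMap.range (symb B) ^ l := by simp only [grade, mul_assoc]
    _ ≤ LinearMap.range (incl B).toLinearMap * grade B k * LinearMap.range (symb B) ^ l :=
        mul_le_mul' (mul_le_mul' le_rfl (symb_pow_mul_incl k)) le_rfl
    _ = (LinearMap.range (incl B).toLinearMap * LinearMap.range (incl B).toLinearMap) *
        LinearMap.range (symb B) ^ (k + l) := by simp only [grade, mul_assoc, pow_add]
    _ ≤ grade B (k + l) := mul_le_mul' hA le_rfl

theorem mul_mem_grade {k l : ℕ} {x y : UniversalForms B} (hx : x ∈ grade B k)
    (hy : y ∈ grade B l) : x * y ∈ grade B (k + l) :=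
  grade_mul k l (Submodule.mul_mem_mul hx hy)

/-- The graded Leibniz rule. -/
theorem leibniz {k l : ℕ} {x y : UniversalForms B} (hx : x ∈ grade B k) (hy : y ∈ grade B l) :
    delta B (x * y) = delta B x * y + (-1) ^ k * (x * delta B y) :=
  delta_mul (grade_le_parity k hx) (grade_le_parity l hy)

theorem delta_grade {k : ℕ} {x : UniversalForms B} (hx : x ∈ grade B k) :
    delta B x ∈ grade B (k + 1) ∧ delta B (delta B x) = 0 := by
  refine Submodule.mul_induction_on hx ?_ ?_
  · rintro _ ⟨a, rfl⟩ y hy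
    obtain ⟨h1, h2⟩ := symb_pow_parity k hy
    have h : delta B (incl B a * y) = symb B a * y := by
      rw [delta_mul (incl_mem_parity a) h1, h2]; simp
    change delta B (incl B a * y) ∈ _ ∧ delta B (delta B (incl B a * y)) = 0
    rw [h]
    refine ⟨?_, ?_⟩
    · have h3 : symb B a * y ∈ LinearMap.range (symb B) ^ (k + 1) := by
        rw [pow_succ']
        exact Submodule.mul_mem_mul ⟨a, rfl⟩ hy
      have := Submodule.mul_mem_mul (LinearMap.mem_range_self (incl B).toLinearMap 1) h3
      simpa [grade] using this
    · rw [delta_mul (symb_mem_parity a) h1, h2]; simp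
  · rintro x y ⟨h1, h2⟩ ⟨h3, h4⟩
    exact ⟨by rw [map_add]; exact add_mem h1 h3, by rw [map_add, map_add, h2, h4, add_zero]⟩

end UniversalForms

end Universal

/-! ### Differential calculi, tameness and metrics -/

section Calculus

open MulOpposite (op op_add op_mul op_one op_zero)

/-- A differential calculus on a `ℂ`-algebra `B`: a differential graded algebra whose degree zero
part is `B` and which is generated, as a differential graded algebra, by degree zero. The product
of `Ω` is the wedge product. -/
structure DifferentialCalculus (B : Type u) [Ring B] [Algebra ℂ B] where
  Ω : Type v
  [ring : Ring Ω]
  [algebra : Algebra ℂ Ω]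
  /-- The forms of each degree. -/
  grade : ℕ → Submodule ℂ Ω
  isInternal : DirectSum.IsInternal grade
  one_mem : (1 : Ω) ∈ grade 0
  mul_mem : ∀ {k l : ℕ} {x y : Ω}, x ∈ grade k → y ∈ grade l → x * y ∈ grade (k + l)
  /-- The identification of `B` with the forms of degree zero. -/
  ι : B →ₐ[ℂ] Ω
  ι_injective : Function.Injective ι
  range_ι : LinearMap.range ι.toLinearMap = grade 0
  d : Ω →ₗ[ℂ] Ω
  d_mem : ∀ {k : ℕ} {x : Ω}, x ∈ grade k → d x ∈ grade (k + 1)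
  d_d : ∀ x : Ω, d (d x) = 0
  leibniz : ∀ {k : ℕ} {x : Ω}, x ∈ grade k → ∀ y : Ω,
    d (x * y) = d x * y + (-1) ^ k * (x * d y)
  generated : ∀ R : Subalgebra ℂ Ω, (∀ a, ι a ∈ R) → (∀ x ∈ R, d x ∈ R) → R = ⊤

attribute [instance] DifferentialCalculus.ring DifferentialCalculus.algebra

namespace DifferentialCalculus

variable {B : Type u} [Ring B] [Algebra ℂ B] (C : DifferentialCalculus.{u, v} B)

/-- The space `Ω^k(B)` of forms of degree `k`. -/
def Form (k : ℕ) : Type v := C.grade k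

instance (k : ℕ) : AddCommGroup (C.Form k) := inferInstanceAs (AddCommGroup (C.grade k))

instance (k : ℕ) : Module ℂ (C.Form k) := inferInstanceAs (Module ℂ (C.grade k))

/-- The inclusion of the forms of degree `k` into all forms. -/
def val (k : ℕ) : C.Form k →ₗ[ℂ] C.Ω := (C.grade k).subtype

instance (k : ℕ) : CoeOut (C.Form k) C.Ω := ⟨C.val k⟩

variable {C} in
/-- A form of degree `k` from an element of `Ω`. -/
def mkForm {k : ℕ} (x : C.Ω) (hx : x ∈ C.grade k) : C.Form k := ⟨x, hx⟩

variable {C} in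
@[simp] theorem val_mkForm {k : ℕ} (x : C.Ω) (hx : x ∈ C.grade k) :
    C.val k (mkForm x hx) = x := rfl

theorem val_mem {k : ℕ} (x : C.Form k) : C.val k x ∈ C.grade k := x.2

variable {C} in
theorem form_ext {k : ℕ} {x y : C.Form k} (h : C.val k x = C.val k y) : x = y := Subtype.ext h

variable {C} in
theorem ι_mul_mem {k : ℕ} (a : B) {x : C.Ω} (hx : x ∈ C.grade k) : C.ι a * x ∈ C.grade k := by
  have ha : C.ι a ∈ C.grade 0 := by rw [← C.range_ι]; exact ⟨a, rfl⟩
  simpa using C.mul_mem ha hx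

variable {C} in
theorem mul_ι_mem {k : ℕ} (a : B) {x : C.Ω} (hx : x ∈ C.grade k) : x * C.ι a ∈ C.grade k := by
  have ha : C.ι a ∈ C.grade 0 := by rw [← C.range_ι]; exact ⟨a, rfl⟩
  simpa using C.mul_mem hx ha

/-- Left multiplication by `B` on forms. -/
instance leftModule (k : ℕ) : Module B (C.Form k) where
  smul a x := mkForm (C.ι a * x) (ι_mul_mem a (C.val_mem x))
  one_smul x := form_ext (by change C.ι 1 * (x : C.Ω) = x; simp)
  mul_smul a b x := form_ext (by
    change C.ι (a * b) * (x : C.Ω) = C.ι a * (C.ι b * x); simp [mul_assoc])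
  smul_zero a := form_ext (by change C.ι a * 0 = 0; simp)
  smul_add a x y := form_ext (by
    change C.ι a * ((x : C.Ω) + y) = C.ι a * x + C.ι a * y; simp [mul_add])
  add_smul a b x := form_ext (by
    change C.ι (a + b) * (x : C.Ω) = C.ι a * x + C.ι b * x; simp [add_mul])
  zero_smul x := form_ext (by change C.ι 0 * (x : C.Ω) = 0; simp)

/-- Right multiplication by `B` on forms. -/
instance rightModule (k : ℕ) : Module Bᵐᵒᵖ (C.Form k) where
  smul a x := mkForm (x * C.ι a.unop) (mul_ι_mem a.unop (C.val_mem x))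
  one_smul x := form_ext (by change (x : C.Ω) * C.ι 1 = x; simp)
  mul_smul a b x := form_ext (by
    change (x : C.Ω) * C.ι (b.unop * a.unop) = x * C.ι b.unop * C.ι a.unop; simp [mul_assoc])
  smul_zero a := form_ext (by change 0 * C.ι a.unop = 0; simp)
  smul_add a x y := form_ext (by
    change ((x : C.Ω) + y) * C.ι a.unop = x * C.ι a.unop + y * C.ι a.unop; simp [add_mul])
  add_smul a b x := form_ext (by
    change (x : C.Ω) * C.ι (a.unop + b.unop) = x * C.ι a.unop + x * C.ι b.unop; simp [mul_add])
  zero_smul x := form_ext (by change (x : C.Ω) * C.ι 0 = 0; simp)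

@[simp] theorem coe_left_smul {k : ℕ} (a : B) (x : C.Form k) :
    ((a • x : C.Form k) : C.Ω) = C.ι a * x := rfl

@[simp] theorem coe_right_smul {k : ℕ} (a : Bᵐᵒᵖ) (x : C.Form k) :
    ((a • x : C.Form k) : C.Ω) = x * C.ι a.unop := rfl

instance (k : ℕ) : SMulCommClass B Bᵐᵒᵖ (C.Form k) where
  smul_comm a b x := form_ext (by simp [mul_assoc])

/-- Left multiplication by `a` as a `ℂ`-linear map. -/
def lmul (k : ℕ) (a : B) : C.Form k →ₗ[ℂ] C.Form k where
  toFun x := a • x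
  map_add' := smul_add a
  map_smul' c x := form_ext (by simp)

/-- Right multiplication by `a` as a `ℂ`-linear map. -/
def rmul (k : ℕ) (a : B) : C.Form k →ₗ[ℂ] C.Form k where
  toFun x := op a • x
  map_add' := smul_add (op a)
  map_smul' c x := form_ext (by simp)

/-- The balancing relations `ω a ⊗ η = ω ⊗ a η`. -/
def balance : Submodule ℂ (C.Form 1 ⊗[ℂ] C.Form 1) :=
  Submodule.span ℂ {t | ∃ (x y : C.Form 1) (a : B), t = (op a • x) ⊗ₜ y - x ⊗ₜ (a • y)}

/-- The balanced tensor product `Ω¹(B) ⊗_B Ω¹(B)`. -/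
def Tensor2 : Type v := (C.Form 1 ⊗[ℂ] C.Form 1) ⧸ C.balance

instance : AddCommGroup C.Tensor2 :=
  inferInstanceAs (AddCommGroup ((C.Form 1 ⊗[ℂ] C.Form 1) ⧸ C.balance))

instance : Module ℂ C.Tensor2 :=
  inferInstanceAs (Module ℂ ((C.Form 1 ⊗[ℂ] C.Form 1) ⧸ C.balance))

/-- The quotient map onto the balanced tensor product. -/
def toTensor2 : (C.Form 1 ⊗[ℂ] C.Form 1) →ₗ[ℂ] C.Tensor2 := C.balance.mkQ

variable {C} in
/-- The simple tensor `x ⊗_B y`. -/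
def tmul (x y : C.Form 1) : C.Tensor2 := C.toTensor2 (x ⊗ₜ y)

theorem toTensor2_surjective : Function.Surjective C.toTensor2 := C.balance.mkQ_surjective

/-- Descent of a linear map on the tensor product over `ℂ`. -/
def descend {M : Type w} [AddCommGroup M] [Module ℂ M] (f : (C.Form 1 ⊗[ℂ] C.Form 1) →ₗ[ℂ] M)
    (hf : ∀ (x y : C.Form 1) (a : B), f ((op a • x) ⊗ₜ y) = f (x ⊗ₜ (a • y))) :
    C.Tensor2 →ₗ[ℂ] M :=
  C.balance.liftQ f (by
    refine Submodule.span_le.2 ?_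
    rintro _ ⟨x, y, a, rfl⟩
    simp [hf])

@[simp] theorem descend_toTensor2 {M : Type w} [AddCommGroup M] [Module ℂ M]
    (f : (C.Form 1 ⊗[ℂ] C.Form 1) →ₗ[ℂ] M)
    (hf : ∀ (x y : C.Form 1) (a : B), f ((op a • x) ⊗ₜ y) = f (x ⊗ₜ (a • y)))
    (t : C.Form 1 ⊗[ℂ] C.Form 1) : C.descend f hf (C.toTensor2 t) = f t := rfl

theorem tmul_balance (x y : C.Form 1) (a : B) : tmul (op a • x) y = tmul x (a • y) :=
  (Submodule.Quotient.eq _).2 (Submodule.subset_span ⟨x, y, a, rfl⟩)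

variable {C} in
theorem tensor2_ext {M : Type w} [AddCommGroup M] [Module ℂ M] {f g : C.Tensor2 →ₗ[ℂ] M}
    (h : ∀ x y : C.Form 1, f (tmul x y) = g (tmul x y)) : f = g := by
  have : f ∘ₗ C.toTensor2 = g ∘ₗ C.toTensor2 := TensorProduct.ext' h
  ext t
  obtain ⟨t, rfl⟩ := C.toTensor2_surjective t
  exact LinearMap.congr_fun this t

/-- `a (x ⊗ y) = (a x) ⊗ y`. -/
def lmul2 (a : B) : C.Tensor2 →ₗ[ℂ] C.Tensor2 :=
  C.descend (C.toTensor2 ∘ₗ TensorProduct.map (C.lmul 1 a) LinearMap.id) (fun x y b => by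
    change tmul (a • op b • x) y = tmul (a • x) (b • y)
    rw [smul_comm, tmul_balance])

/-- `(x ⊗ y) a = x ⊗ (y a)`. -/
def rmul2 (a : B) : C.Tensor2 →ₗ[ℂ] C.Tensor2 :=
  C.descend (C.toTensor2 ∘ₗ TensorProduct.map LinearMap.id (C.rmul 1 a)) (fun x y b => by
    change tmul (op b • x) (op a • y) = tmul x (op a • b • y)
    rw [tmul_balance, smul_comm])

theorem lmul2_tmul (a : B) (x y : C.Form 1) : C.lmul2 a (tmul x y) = tmul (a • x) y := rfl

theorem rmul2_tmul (a : B) (x y : C.Form 1) : C.rmul2 a (tmul x y) = tmul x (op a • y) := rfl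

theorem tmul_add (x y z : C.Form 1) : tmul x (y + z) = tmul x y + tmul x z := by
  simp [tmul, TensorProduct.tmul_add]

theorem add_tmul (x y z : C.Form 1) : tmul (x + y) z = tmul x z + tmul y z := by
  simp [tmul, TensorProduct.add_tmul]

/-- The left module structure of `Ω¹(B) ⊗_B Ω¹(B)`. -/
instance leftModule2 : Module B C.Tensor2 where
  smul a t := C.lmul2 a t
  one_smul t := by
    have : C.lmul2 1 = LinearMap.id := tensor2_ext fun x y => by rw [lmul2_tmul, one_smul]; rfl
    exact LinearMap.congr_fun this t
  mul_smul a b t := by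
    have : C.lmul2 (a * b) = C.lmul2 a ∘ₗ C.lmul2 b := tensor2_ext fun x y => by
      rw [LinearMap.comp_apply, lmul2_tmul, lmul2_tmul, lmul2_tmul, mul_smul]
    exact LinearMap.congr_fun this t
  smul_zero a := map_zero (C.lmul2 a)
  smul_add a := map_add (C.lmul2 a)
  add_smul a b t := by
    have : C.lmul2 (a + b) = C.lmul2 a + C.lmul2 b := tensor2_ext fun x y => by
      rw [LinearMap.add_apply, lmul2_tmul, lmul2_tmul, lmul2_tmul, add_smul, add_tmul]
    exact LinearMap.congr_fun this t
  zero_smul t := by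
    have : C.lmul2 0 = 0 := tensor2_ext fun x y => by
      rw [lmul2_tmul, zero_smul]; simp [tmul]
    exact LinearMap.congr_fun this t

/-- The right module structure of `Ω¹(B) ⊗_B Ω¹(B)`. -/
instance rightModule2 : Module Bᵐᵒᵖ C.Tensor2 where
  smul a t := C.rmul2 a.unop t
  one_smul t := by
    have : C.rmul2 1 = LinearMap.id := tensor2_ext fun x y => by
      rw [rmul2_tmul, op_one, one_smul]; rfl
    exact LinearMap.congr_fun this t
  mul_smul a b t := by
    have : C.rmul2 (b.unop * a.unop) = C.rmul2 a.unop ∘ₗ C.rmul2 b.unop :=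
      tensor2_ext fun x y => by
        rw [LinearMap.comp_apply, rmul2_tmul, rmul2_tmul, rmul2_tmul, op_mul, mul_smul]
    exact LinearMap.congr_fun this t
  smul_zero a := map_zero (C.rmul2 a.unop)
  smul_add a := map_add (C.rmul2 a.unop)
  add_smul a b t := by
    have : C.rmul2 (a.unop + b.unop) = C.rmul2 a.unop + C.rmul2 b.unop :=
      tensor2_ext fun x y => by
        rw [LinearMap.add_apply, rmul2_tmul, rmul2_tmul, rmul2_tmul, op_add, add_smul, tmul_add]
    exact LinearMap.congr_fun this t
  zero_smul t := by
    have : C.rmul2 0 = 0 := tensor2_ext fun x y => by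
      rw [rmul2_tmul, op_zero, zero_smul]; simp [tmul]
    exact LinearMap.congr_fun this t

theorem left_smul_tmul (a : B) (x y : C.Form 1) : a • tmul x y = tmul (a • x) y := rfl

theorem right_smul_tmul (a : Bᵐᵒᵖ) (x y : C.Form 1) : a • tmul x y = tmul x (a • y) := rfl

/-- The product of two one-forms, as a `ℂ`-bilinear map. -/
def wedgeBilin : C.Form 1 →ₗ[ℂ] C.Form 1 →ₗ[ℂ] C.Form 2 :=
  LinearMap.mk₂ ℂ (fun x y => mkForm ((x : C.Ω) * y) (C.mul_mem (C.val_mem x) (C.val_mem y)))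
    (fun _ _ _ => form_ext (add_mul _ _ _)) (fun _ _ _ => form_ext (smul_mul_assoc _ _ _))
    (fun _ _ _ => form_ext (mul_add _ _ _)) (fun _ _ _ => form_ext (mul_smul_comm _ _ _))

/-- The wedge map `∧ : Ω¹(B) ⊗_B Ω¹(B) → Ω²(B)`, a right `B`-linear map. -/
def wedge : C.Tensor2 →ₗ[Bᵐᵒᵖ] C.Form 2 where
  toFun := C.descend (TensorProduct.lift C.wedgeBilin) (fun x y a => form_ext (by
    simp [wedgeBilin, mul_assoc]))
  map_add' := map_add _
  map_smul' a t := by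
    have : C.descend (TensorProduct.lift C.wedgeBilin) (fun x y a => form_ext (by
        simp [wedgeBilin, mul_assoc])) ∘ₗ C.rmul2 a.unop =
        C.rmul 2 a.unop ∘ₗ C.descend (TensorProduct.lift C.wedgeBilin) (fun x y a =>
          form_ext (by simp [wedgeBilin, mul_assoc])) := tensor2_ext fun x y => by
      refine form_ext ?_
      change (x : C.Ω) * (y * C.ι a.unop) = x * y * C.ι a.unop
      rw [mul_assoc]
    exact LinearMap.congr_fun this t

@[simp] theorem wedge_tmul (x y : C.Form 1) : (C.wedge (tmul x y) : C.Ω) = x * y := rfl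

/-- The center of the bimodule of one-forms, a module over the center of `B`. -/
def center : Submodule (Subalgebra.center ℂ B) (C.Form 1) where
  carrier := {x | ∀ a : B, a • x = op a • x}
  add_mem' hx hy a := by rw [smul_add, smul_add, hx a, hy a]
  zero_mem' a := by rw [smul_zero, smul_zero]
  smul_mem' z x hx a := by
    change a • (z : B) • x = op a • (z : B) • x
    rw [← smul_comm (z : B) (op a) x, ← hx a, ← mul_smul, ← mul_smul, Subalgebra.mem_center_iff.1 z.2 a]

/-- The map `Z(Ω¹(B)) ⊗_{Z(B)} B → Ω¹(B)`, `e ⊗ a ↦ e a`. -/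
def centerMap : (C.center ⊗[Subalgebra.center ℂ B] B) →ₗ[Subalgebra.center ℂ B] C.Form 1 :=
  TensorProduct.lift (LinearMap.mk₂ (Subalgebra.center ℂ B)
    (fun (x : C.center) (a : B) => op a • (x : C.Form 1))
    (fun x y a => smul_add _ _ _)
    (fun z x a => (smul_comm (z : B) (op a) (x : C.Form 1)).symm)
    (fun x a b => by rw [op_add, add_smul])
    (fun z x a => by
      change op ((z : B) * a) • (x : C.Form 1) = (z : B) • op a • (x : C.Form 1)
      rw [op_mul, mul_smul, ← x.2 (z : B), ← smul_comm (z : B) (op a)]))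

/-- The calculus is quasi-tame with idempotent `P = P_sym`: one-forms are finitely generated
projective on the right, the sequence `0 → ker ∧ → Ω¹ ⊗_B Ω¹ → Ω² → 0` is exact and split on the
right by `F = ker P`, and the idempotent `P` with range `ker ∧` is a bimodule map. -/
structure IsQuasiTame (P : C.Tensor2 →ₗ[Bᵐᵒᵖ] C.Tensor2) : Prop where
  finite : Module.Finite Bᵐᵒᵖ (C.Form 1)
  projective : Module.Projective Bᵐᵒᵖ (C.Form 1)
  wedge_surjective : Function.Surjective C.wedge
  idem : P ∘ₗ P = P
  range_eq : LinearMap.range P = LinearMap.ker C.wedge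
  left_linear : ∀ (a : B) (t : C.Tensor2), P (a • t) = a • P t

variable {C} in
/-- The map `σ = 2 P_sym - 1`. -/
def sigma (P : C.Tensor2 →ₗ[Bᵐᵒᵖ] C.Tensor2) : C.Tensor2 →ₗ[Bᵐᵒᵖ] C.Tensor2 :=
  2 • P - LinearMap.id

/-- The calculus is tame with idempotent `P = P_sym`. -/
structure IsTame (P : C.Tensor2 →ₗ[Bᵐᵒᵖ] C.Tensor2) : Prop extends C.IsQuasiTame P where
  centered : Function.Bijective C.centerMap
  sigma_flip : ∀ x ∈ C.center, ∀ y ∈ C.center, sigma P (tmul x y) = tmul y x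

variable {C} in
/-- `V_g(x)(y) = g(x ⊗ y)`. -/
def metricDual (g : C.Tensor2 →ₗ[Bᵐᵒᵖ] B) (x : C.Form 1) : C.Form 1 →ₗ[Bᵐᵒᵖ] B where
  toFun y := g (tmul x y)
  map_add' y z := by rw [tmul_add, map_add]
  map_smul' a y := by rw [← right_smul_tmul, map_smul]; rfl

/-- A pseudo-Riemannian metric on a quasi-tame calculus with idempotent `P = P_sym`: a right
`B`-linear map `g : Ω¹ ⊗_B Ω¹ → B` with `g ∘ σ = g` for which `V_g : Ω¹ → (Ω¹)^*` is bijective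
(`V_g` is always right `B`-linear). -/
structure IsPseudoRiemannianMetric (P : C.Tensor2 →ₗ[Bᵐᵒᵖ] C.Tensor2)
    (g : C.Tensor2 →ₗ[Bᵐᵒᵖ] B) : Prop where
  symmetric : g ∘ₗ sigma P = g
  nondegenerate : Function.Bijective (metricDual g)

/-- A bilinear pseudo-Riemannian metric: one that is also left `B`-linear. -/
structure IsBilinearMetric (P : C.Tensor2 →ₗ[Bᵐᵒᵖ] C.Tensor2)
    (g : C.Tensor2 →ₗ[Bᵐᵒᵖ] B) : Prop extends C.IsPseudoRiemannianMetric P g where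
  left_linear : ∀ (a : B) (t : C.Tensor2), g (a • t) = a * g t

end DifferentialCalculus

end Calculus

/-! ### Dirac triples and Connes' space of forms -/

section Connes

/-- A Dirac triple: a `*`-algebra `B` faithfully represented on a Hilbert space `H` and a densely
defined operator `D` on `H` whose commutators with `B` extend to bounded operators. -/
structure DiracTriple (B : Type u) [Ring B] [StarRing B] [Algebra ℂ B] (H : Type w)
    [NormedAddCommGroup H] [InnerProductSpace ℂ H] [CompleteSpace H] where
  π : B →⋆ₐ[ℂ] (H →L[ℂ] H)
  faithful : Function.Injective π
  D : H →ₗ.[ℂ] H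
  dense : Dense (D.domain : Set H)
  domain_mem : ∀ (a : B) (x : H), x ∈ D.domain → π a x ∈ D.domain
  bounded : ∀ a : B, ∃ T : H →L[ℂ] H, ∀ x : D.domain,
    T x = D ⟨π a x, domain_mem a x x.2⟩ - π a (D x)

namespace DiracTriple

variable {B : Type u} [Ring B] [StarRing B] [Algebra ℂ B] {H : Type w}
    [NormedAddCommGroup H] [InnerProductSpace ℂ H] [CompleteSpace H] (T : DiracTriple B H)

/-- The bounded operator extending `[D, π a]`. -/
def comm (a : B) : H →L[ℂ] H := (T.bounded a).choose

theorem comm_apply (a : B) (x : T.D.domain) :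
    T.comm a x = T.D ⟨T.π a x, T.domain_mem a x x.2⟩ - T.π a (T.D x) :=
  (T.bounded a).choose_spec x

theorem comm_unique (a : B) (S : H →L[ℂ] H) (hS : ∀ x : T.D.domain,
    S x = T.D ⟨T.π a x, T.domain_mem a x x.2⟩ - T.π a (T.D x)) : T.comm a = S := by
  refine ContinuousLinearMap.coeFn_injective (Continuous.ext_on T.dense (T.comm a).continuous
    S.continuous ?_)
  intro x hx
  rw [T.comm_apply a ⟨x, hx⟩, hS ⟨x, hx⟩]

/-- The derivation `a ↦ [D, π a]`. -/
def commL : B →ₗ[ℂ] (H →L[ℂ] H) where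
  toFun := T.comm
  map_add' a b := T.comm_unique _ _ fun x => by
    have h : (⟨T.π (a + b) x, T.domain_mem (a + b) x x.2⟩ : T.D.domain) =
        ⟨T.π a x, T.domain_mem a x x.2⟩ + ⟨T.π b x, T.domain_mem b x x.2⟩ :=
      Subtype.ext (by simp)
    rw [h, T.D.map_add, add_apply, T.comm_apply, T.comm_apply, map_add,
      add_apply]
    abel
  map_smul' c a := T.comm_unique _ _ fun x => by
    have h : (⟨T.π (c • a) x, T.domain_mem (c • a) x x.2⟩ : T.D.domain) =
        c • ⟨T.π a x, T.domain_mem a x x.2⟩ :=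
      Subtype.ext (by simp)
    rw [h, T.D.map_smul, RingHom.id_apply, smul_apply, T.comm_apply, map_smul,
      smul_apply, smul_sub]

theorem commL_mul (a b : B) :
    T.commL (a * b) = T.commL a * T.π b + T.π a * T.commL b := T.comm_unique _ _ fun x => by
  have h : (⟨T.π (a * b) x, T.domain_mem (a * b) x x.2⟩ : T.D.domain) =
      ⟨T.π a (T.π b x), T.domain_mem a _ (T.domain_mem b x x.2)⟩ :=
    Subtype.ext (by simp)
  have h1 := T.comm_apply a ⟨T.π b x, T.domain_mem b x x.2⟩
  have h2 := T.comm_apply b x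
  change T.comm a (T.π b x) + T.π a (T.comm b x) = _
  rw [h, h2, map_sub, map_mul, mul_apply_eq_comp]
  simp only at h1
  rw [h1]
  abel

/-- The representation `Π(a₀ δ a₁ ⋯ δ aₖ) = a₀ [D, a₁] ⋯ [D, aₖ]` of the universal forms. -/
def rep : UniversalForms B →ₐ[ℂ] (H →L[ℂ] H) :=
  UniversalForms.lift T.π.toAlgHom T.commL T.commL_mul

/-- `J₀^k`, the universal `k`-forms represented by zero. -/
def J (k : ℕ) : Submodule ℂ (UniversalForms B) :=
  UniversalForms.grade B k ⊓ LinearMap.ker T.rep.toLinearMap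

/-- `Π(Ω^k)`. -/
def opForms (k : ℕ) : Submodule ℂ (H →L[ℂ] H) :=
  (UniversalForms.grade B k).map T.rep.toLinearMap

/-- The junk forms `Π(δ J₀^{k-1})` in degree `k`. -/
def junk : ℕ → Submodule ℂ (H →L[ℂ] H)
  | 0 => ⊥
  | k + 1 => ((T.J k).map (UniversalForms.delta B)).map T.rep.toLinearMap

/-- Connes' space `Ω^k_D = Π(Ω^k) / Π(δ J₀^{k-1})` of `k`-forms. -/
def ConnesForm (k : ℕ) : Type w := T.opForms k ⧸ (T.junk k).submoduleOf (T.opForms k)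

instance (k : ℕ) : AddCommGroup (T.ConnesForm k) :=
  inferInstanceAs (AddCommGroup (T.opForms k ⧸ (T.junk k).submoduleOf (T.opForms k)))

instance (k : ℕ) : Module ℂ (T.ConnesForm k) :=
  inferInstanceAs (Module ℂ (T.opForms k ⧸ (T.junk k).submoduleOf (T.opForms k)))

/-- The class in `Ω^k_D` of an operator in `Π(Ω^k)`. -/
def cls (k : ℕ) : T.opForms k →ₗ[ℂ] T.ConnesForm k :=
  ((T.junk k).submoduleOf (T.opForms k)).mkQ

theorem cls_surjective (k : ℕ) : Function.Surjective (T.cls k) := Submodule.mkQ_surjective _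

theorem cls_eq_zero {k : ℕ} (x : T.opForms k) : T.cls k x = 0 ↔ (x : H →L[ℂ] H) ∈ T.junk k :=
  Submodule.Quotient.mk_eq_zero _

theorem rep_mem {k : ℕ} {x : UniversalForms B} (hx : x ∈ UniversalForms.grade B k) :
    T.rep x ∈ T.opForms k := ⟨x, hx, rfl⟩

theorem opForms_mul {k l : ℕ} {x y : H →L[ℂ] H} (hx : x ∈ T.opForms k) (hy : y ∈ T.opForms l) :
    x * y ∈ T.opForms (k + l) := by
  obtain ⟨a, ha, rfl⟩ := hx
  obtain ⟨b, hb, rfl⟩ := hy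
  exact ⟨a * b, UniversalForms.mul_mem_grade ha hb, by simp⟩

theorem junk_mul {k l : ℕ} {x y : H →L[ℂ] H} (hx : x ∈ T.junk k) (hy : y ∈ T.opForms l) :
    x * y ∈ T.junk (k + l) := by
  obtain ⟨b, hb, rfl⟩ := hy
  cases k with
  | zero =>
    have h0 : x = 0 := hx
    rw [h0, zero_mul]; exact zero_mem _
  | succ k =>
    obtain ⟨_, ⟨a, ⟨ha, ha'⟩, rfl⟩, rfl⟩ := hx
    have ha0 : T.rep a = 0 := ha'
    rw [Nat.succ_add]
    refine ⟨_, ⟨a * b, ⟨UniversalForms.mul_mem_grade ha hb, ?_⟩, rfl⟩, ?_⟩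
    · change T.rep (a * b) = 0
      rw [map_mul, ha0, zero_mul]
    · change T.rep (UniversalForms.delta B (a * b)) = T.rep (UniversalForms.delta B a) * T.rep b
      rw [UniversalForms.leibniz ha hb]
      simp [ha0]

theorem mul_junk {k l : ℕ} {x y : H →L[ℂ] H} (hx : x ∈ T.opForms k) (hy : y ∈ T.junk l) :
    x * y ∈ T.junk (k + l) := by
  obtain ⟨a, ha, rfl⟩ := hx
  cases l with
  | zero =>
    have h0 : y = 0 := hy
    rw [h0, mul_zero]; exact zero_mem _
  | succ l =>
    obtain ⟨_, ⟨b, ⟨hb, hb'⟩, rfl⟩, rfl⟩ := hy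
    have hb0 : T.rep b = 0 := hb'
    refine ⟨_, ⟨(-1) ^ k * (a * b), ⟨?_, ?_⟩, rfl⟩, ?_⟩
    · have h := (UniversalForms.grade B (k + l)).smul_mem ((-1 : ℂ) ^ k)
        (UniversalForms.mul_mem_grade ha hb)
      simpa [Algebra.smul_def] using h
    · change T.rep ((-1) ^ k * (a * b)) = 0
      simp [hb0]
    · have h1 : (-1) ^ k * (a * b) = ((-1 : ℂ) ^ k) • (a * b) := by simp [Algebra.smul_def]
      change T.rep (UniversalForms.delta B ((-1) ^ k * (a * b))) =
        T.rep a * T.rep (UniversalForms.delta B b)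
      rw [h1, map_smul, UniversalForms.leibniz ha hb, map_smul, map_add, map_mul, hb0, mul_zero,
        zero_add, map_mul, map_mul, Algebra.smul_def, ← mul_assoc]
      have h2 : algebraMap ℂ (H →L[ℂ] H) ((-1) ^ k) * T.rep ((-1) ^ k) = 1 := by
        simp [← pow_add, Even.neg_one_pow ⟨k, rfl⟩]
      rw [h2, one_mul]

/-- The product of operators on representatives. -/
def preMul (k l : ℕ) : T.opForms k →ₗ[ℂ] T.opForms l →ₗ[ℂ] T.ConnesForm (k + l) :=
  LinearMap.mk₂ ℂ (fun x y => T.cls (k + l) ⟨x * y, T.opForms_mul x.2 y.2⟩)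
    (fun x y z => by
      rw [← map_add]; exact congrArg (T.cls (k + l)) (Subtype.ext (add_mul _ _ _)))
    (fun c x y => by
      rw [← map_smul]; exact congrArg (T.cls (k + l)) (Subtype.ext (smul_mul_assoc _ _ _)))
    (fun x y z => by
      rw [← map_add]; exact congrArg (T.cls (k + l)) (Subtype.ext (mul_add _ _ _)))
    (fun c x y => by
      rw [← map_smul]; exact congrArg (T.cls (k + l)) (Subtype.ext (mul_smul_comm _ _ _)))

/-- The product `Ω^k_D × Ω^l_D → Ω^{k+l}_D` induced by the product of operators. -/
def mulForm (k l : ℕ) : T.ConnesForm k →ₗ[ℂ] T.ConnesForm l →ₗ[ℂ] T.ConnesForm (k + l) :=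
  Submodule.liftQ _ (LinearMap.flip (Submodule.liftQ _ (T.preMul k l).flip (by
      intro y hy
      refine LinearMap.ext fun x => ?_
      exact (T.cls_eq_zero _).2 (T.mul_junk x.2 hy)))) (by
    intro x hx
    refine LinearMap.ext fun y => ?_
    obtain ⟨y, rfl⟩ := T.cls_surjective l y
    exact (T.cls_eq_zero _).2 (T.junk_mul hx y.2))

theorem mulForm_cls (k l : ℕ) (x : T.opForms k) (y : T.opForms l) :
    T.mulForm k l (T.cls k x) (T.cls l y) = T.cls (k + l) ⟨x * y, T.opForms_mul x.2 y.2⟩ := rfl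

theorem mk_cls_congr {k l : ℕ} (h : k = l) (x : T.opForms k) (y : T.opForms l)
    (hxy : (x : H →L[ℂ] H) = y) :
    GradedMonoid.mk (A := T.ConnesForm) k (T.cls k x) = GradedMonoid.mk l (T.cls l y) := by
  subst h
  rw [Subtype.ext hxy]

theorem one_mem_opForms : (1 : H →L[ℂ] H) ∈ T.opForms 0 :=
  ⟨1, by simpa using UniversalForms.incl_mem_grade (1 : B), by simp⟩

instance : GradedMonoid.GMul T.ConnesForm := ⟨fun {k l} x y => T.mulForm k l x y⟩

instance : GradedMonoid.GOne T.ConnesForm := ⟨T.cls 0 ⟨1, T.one_mem_opForms⟩⟩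

instance connesGRing : DirectSum.GRing T.ConnesForm where
  mul_zero a := map_zero _
  zero_mul b := by
    change T.mulForm _ _ 0 b = 0
    simp
  mul_add a b c := map_add _ _ _
  add_mul a b c := by
    change T.mulForm _ _ (a + b) c = _
    rw [map_add]; rfl
  one_mul := by
    rintro ⟨k, x⟩
    obtain ⟨x, rfl⟩ := T.cls_surjective k x
    exact T.mk_cls_congr (zero_add k) _ _ (one_mul _)
  mul_one := by
    rintro ⟨k, x⟩
    obtain ⟨x, rfl⟩ := T.cls_surjective k x
    exact T.mk_cls_congr (add_zero k) _ _ (mul_one _)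
  mul_assoc := by
    rintro ⟨k, x⟩ ⟨l, y⟩ ⟨m, z⟩
    obtain ⟨x, rfl⟩ := T.cls_surjective k x
    obtain ⟨y, rfl⟩ := T.cls_surjective l y
    obtain ⟨z, rfl⟩ := T.cls_surjective m z
    exact T.mk_cls_congr (add_assoc k l m) _ _ (mul_assoc _ _ _)
  natCast n := (n : ℕ) • (GradedMonoid.GOne.one : T.ConnesForm 0)
  natCast_zero := zero_smul _ _
  natCast_succ n := succ_nsmul _ _
  intCast n := (n : ℤ) • (GradedMonoid.GOne.one : T.ConnesForm 0)
  intCast_ofNat n := natCast_zsmul _ _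
  intCast_negSucc_ofNat n := negSucc_zsmul _ _

instance connesGAlgebra : DirectSum.GAlgebra ℂ T.ConnesForm where
  toFun := ((LinearMap.toSpanSingleton ℂ (T.ConnesForm 0)
    (GradedMonoid.GOne.one : T.ConnesForm 0))).toAddMonoidHom
  map_one := one_smul ℂ (GradedMonoid.GOne.one : T.ConnesForm 0)
  map_mul r s := T.mk_cls_congr (add_zero 0).symm ((r * s) • ⟨1, T.one_mem_opForms⟩)
    ⟨(r • (1 : H →L[ℂ] H)) * (s • 1), _⟩ (by
      change (r * s) • (1 : H →L[ℂ] H) = _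
      simp [smul_smul, mul_comm])
  commutes r := by
    rintro ⟨k, x⟩
    obtain ⟨x, rfl⟩ := T.cls_surjective k x
    exact T.mk_cls_congr (add_comm 0 k) ⟨(r • (1 : H →L[ℂ] H)) * x, _⟩
      ⟨(x : H →L[ℂ] H) * (r • 1), _⟩ (by simp)
  smul_def r := by
    rintro ⟨k, x⟩
    obtain ⟨x, rfl⟩ := T.cls_surjective k x
    exact T.mk_cls_congr (zero_add k).symm (r • x) ⟨(r • (1 : H →L[ℂ] H)) * x, _⟩ (by simp)

/-- The class in `Ω^k_D` of a universal `k`-form. -/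
def proj (k : ℕ) : UniversalForms.grade B k →ₗ[ℂ] T.ConnesForm k where
  toFun x := T.cls k ⟨T.rep x, T.rep_mem x.2⟩
  map_add' x y := by rw [← map_add]; congr 1; exact Subtype.ext (map_add _ _ _)
  map_smul' c x := by
    rw [RingHom.id_apply, ← map_smul]; congr 1; exact Subtype.ext (map_smul T.rep c _)

theorem proj_surjective (k : ℕ) : Function.Surjective (T.proj k) := by
  intro x
  obtain ⟨⟨_, ⟨a, ha, rfl⟩⟩, rfl⟩ := T.cls_surjective k x
  exact ⟨⟨a, ha⟩, rfl⟩

/-- The universal differential between homogeneous components. -/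
def deltaGrade (B : Type u) [Ring B] [Algebra ℂ B] (k : ℕ) :
    UniversalForms.grade B k →ₗ[ℂ] UniversalForms.grade B (k + 1) :=
  (UniversalForms.delta B).restrict fun _ hx => (UniversalForms.delta_grade hx).1

theorem proj_delta_eq_zero {k : ℕ} (x : UniversalForms.grade B k) (hx : T.proj k x = 0) :
    T.proj (k + 1) (deltaGrade B k x) = 0 := by
  have h := (T.cls_eq_zero _).1 hx
  refine (T.cls_eq_zero _).2 ?_
  change T.rep x ∈ T.junk k at h
  change T.rep (UniversalForms.delta B x) ∈ T.junk (k + 1)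
  cases k with
  | zero =>
    exact ⟨_, ⟨x, ⟨x.2, h⟩, rfl⟩, rfl⟩
  | succ k =>
    obtain ⟨_, ⟨a, ⟨ha, _⟩, rfl⟩, h1⟩ := h
    have h2 := UniversalForms.delta_grade ha
    refine ⟨_, ⟨x - UniversalForms.delta B a, ⟨sub_mem x.2 h2.1, ?_⟩, rfl⟩, ?_⟩
    · change T.rep _ = 0
      rw [map_sub, sub_eq_zero]; exact h1.symm
    · rw [map_sub, h2.2, sub_zero]; rfl

/-- The differential `d : Ω^k_D → Ω^{k+1}_D`, `d [Π ω] = [Π (δ ω)]`. -/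
def dForm (k : ℕ) : T.ConnesForm k →ₗ[ℂ] T.ConnesForm (k + 1) :=
  (Submodule.liftQ (LinearMap.ker (T.proj k)) (T.proj (k + 1) ∘ₗ deltaGrade B k)
    (fun x hx => T.proj_delta_eq_zero x hx)) ∘ₗ
    ((T.proj k).quotKerEquivOfSurjective (T.proj_surjective k)).symm.toLinearMap

theorem dForm_proj (k : ℕ) (x : UniversalForms.grade B k) :
    T.dForm k (T.proj k x) = T.proj (k + 1) (deltaGrade B k x) := by
  have h : ((T.proj k).quotKerEquivOfSurjective (T.proj_surjective k)).symm (T.proj k x) =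
      Submodule.Quotient.mk x := by
    rw [LinearEquiv.symm_apply_eq]; rfl
  rw [dForm, LinearMap.comp_apply, LinearEquiv.coe_coe, h]; rfl

/-- The differential on `⊕_k Ω^k_D`. -/
def dTotal : (⨁ k, T.ConnesForm k) →ₗ[ℂ] ⨁ k, T.ConnesForm k :=
  DirectSum.toModule ℂ ℕ _ fun k => DirectSum.lof ℂ ℕ T.ConnesForm (k + 1) ∘ₗ T.dForm k

/-- The class in `⊕_k Ω^k_D` of a universal `k`-form. -/
def totalProj (k : ℕ) : UniversalForms.grade B k →ₗ[ℂ] ⨁ k, T.ConnesForm k :=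
  DirectSum.lof ℂ ℕ T.ConnesForm k ∘ₗ T.proj k

theorem mem_range_lof {k : ℕ} {x : ⨁ k, T.ConnesForm k} :
    x ∈ LinearMap.range (DirectSum.lof ℂ ℕ T.ConnesForm k) ↔ ∃ y, T.totalProj k y = x := by
  constructor
  · rintro ⟨y, rfl⟩
    obtain ⟨z, rfl⟩ := T.proj_surjective k y
    exact ⟨z, rfl⟩
  · rintro ⟨y, rfl⟩
    exact ⟨_, rfl⟩

theorem totalProj_congr {k l : ℕ} (h : k = l) (x : UniversalForms.grade B k)
    (y : UniversalForms.grade B l) (hxy : (x : UniversalForms B) = y) :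
    T.totalProj k x = T.totalProj l y := by
  subst h; rw [Subtype.ext hxy]

theorem totalProj_mul {k l : ℕ} (x : UniversalForms.grade B k) (y : UniversalForms.grade B l) :
    T.totalProj k x * T.totalProj l y =
      T.totalProj (k + l) ⟨x * y, UniversalForms.mul_mem_grade x.2 y.2⟩ := by
  change DirectSum.of T.ConnesForm k _ * DirectSum.of T.ConnesForm l _ =
    DirectSum.of T.ConnesForm (k + l) _
  rw [DirectSum.of_mul_of]
  congr 1
  change T.cls (k + l) _ = T.cls (k + l) _
  congr 1
  exact Subtype.ext (map_mul _ _ _).symm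

theorem dTotal_totalProj {k : ℕ} (x : UniversalForms.grade B k) :
    T.dTotal (T.totalProj k x) = T.totalProj (k + 1) (deltaGrade B k x) := by
  simp [dTotal, totalProj, dForm_proj]

theorem total_induction {p : (⨁ k, T.ConnesForm k) → Prop} (x : ⨁ k, T.ConnesForm k)
    (h0 : p 0) (hadd : ∀ x y, p x → p y → p (x + y))
    (h : ∀ (k : ℕ) (y : UniversalForms.grade B k), p (T.totalProj k y)) : p x := by
  induction x using DirectSum.induction_on with
  | zero => exact h0
  | of k y =>
    obtain ⟨y, rfl⟩ := T.proj_surjective k y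
    exact h k y
  | add x y hx hy => exact hadd x y hx hy

/-- The inclusion of `B` in `⊕_k Ω^k_D` as the forms of degree zero. -/
def inclTotal : B →ₐ[ℂ] ⨁ k, T.ConnesForm k :=
  AlgHom.ofLinearMap
    (T.totalProj 0 ∘ₗ (UniversalForms.incl B).toLinearMap.codRestrict _
      UniversalForms.incl_mem_grade)
    (by
      change DirectSum.of T.ConnesForm 0 (T.cls 0 _) = DirectSum.of T.ConnesForm 0 (T.cls 0 _)
      congr 2
      exact Subtype.ext (by
        change T.rep (UniversalForms.incl B 1) = 1
        simp))
    (fun a b => by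
      simp only [LinearMap.comp_apply, totalProj_mul]
      exact T.totalProj_congr rfl _ _ (map_mul (UniversalForms.incl B) a b))

theorem inclTotal_apply (a : B) :
    T.inclTotal a = T.totalProj 0 ⟨_, UniversalForms.incl_mem_grade a⟩ := rfl

/-- Connes' space of forms of a Dirac triple as a differential calculus. -/
def connesCalculus : DifferentialCalculus.{u, w} B where
  Ω := ⨁ k, T.ConnesForm k
  grade k := LinearMap.range (DirectSum.lof ℂ ℕ T.ConnesForm k)
  isInternal := by
    let e : ∀ k, T.ConnesForm k ≃ₗ[ℂ] LinearMap.range (DirectSum.lof ℂ ℕ T.ConnesForm k) :=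
      fun k => LinearEquiv.ofInjective _ (DirectSum.of_injective (β := T.ConnesForm) k)
    let E := DFinsupp.mapRange.linearEquiv e
    have h : DirectSum.coeLinearMap (fun k => LinearMap.range (DirectSum.lof ℂ ℕ T.ConnesForm k))
        ∘ₗ E.toLinearMap = LinearMap.id := by
      refine DirectSum.linearMap_ext ℂ fun k => LinearMap.ext fun x => ?_
      have h1 : E (DirectSum.lof ℂ ℕ T.ConnesForm k x) = DirectSum.lof ℂ ℕ
          (fun k => LinearMap.range (DirectSum.lof ℂ ℕ T.ConnesForm k)) k (e k x) :=
        DFinsupp.mapRange_single (hf := fun i => map_zero (e i))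
      change DirectSum.coeLinearMap _ (E (DirectSum.lof ℂ ℕ T.ConnesForm k x)) = _
      rw [h1, DirectSum.coeLinearMap_lof]
      rfl
    have h2 : ∀ x, DirectSum.coeLinearMap
        (fun k => LinearMap.range (DirectSum.lof ℂ ℕ T.ConnesForm k)) x = E.symm x := fun x => by
      have := LinearMap.congr_fun h (E.symm x)
      simpa using this
    have h3 : (DirectSum.coeAddMonoidHom
        (fun k => LinearMap.range (DirectSum.lof ℂ ℕ T.ConnesForm k)) : _ → _) = E.symm :=
      funext h2
    rw [DirectSum.IsInternal, h3]
    exact E.symm.bijective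
  one_mem := ⟨_, rfl⟩
  mul_mem := by
    intro k l x y hx hy
    obtain ⟨x, rfl⟩ := T.mem_range_lof.1 hx
    obtain ⟨y, rfl⟩ := T.mem_range_lof.1 hy
    rw [totalProj_mul]
    exact ⟨_, rfl⟩
  ι := T.inclTotal
  ι_injective := by
    refine (injective_iff_map_eq_zero _).2 fun a ha => ?_
    have h1 : T.proj 0 ⟨_, UniversalForms.incl_mem_grade a⟩ = 0 :=
      DirectSum.of_injective (β := T.ConnesForm) 0 (ha.trans (map_zero _).symm)
    have h2 := (T.cls_eq_zero _).1 h1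
    have h3 : T.rep (UniversalForms.incl B a) = 0 := h2
    have h4 : T.π a = 0 := by simpa [rep] using h3
    exact T.faithful (by rw [h4, map_zero])
  range_ι := by
    ext x
    rw [T.mem_range_lof]
    constructor
    · rintro ⟨a, rfl⟩
      exact ⟨_, rfl⟩
    · rintro ⟨⟨y, hy⟩, rfl⟩
      have hy' := hy
      rw [UniversalForms.grade, pow_zero, mul_one] at hy'
      obtain ⟨a, rfl⟩ := hy'
      exact ⟨a, rfl⟩
  d := T.dTotal
  d_mem := by
    intro k x hx
    obtain ⟨x, rfl⟩ := T.mem_range_lof.1 hx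
    rw [dTotal_totalProj]
    exact ⟨_, rfl⟩
  d_d := by
    intro x
    refine T.total_induction (p := fun x => T.dTotal (T.dTotal x) = 0) x (by simp)
      (fun x y hx hy => by rw [map_add, map_add, hx, hy, add_zero]) fun k y => ?_
    rw [dTotal_totalProj, dTotal_totalProj]
    have h : deltaGrade B (k + 1) (deltaGrade B k y) = 0 :=
      Subtype.ext (UniversalForms.delta_grade y.2).2
    rw [h, map_zero]
  leibniz := by
    intro k x hx y
    obtain ⟨x, rfl⟩ := T.mem_range_lof.1 hx
    refine T.total_induction (p := fun y => T.dTotal (T.totalProj k x * y) =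
      T.dTotal (T.totalProj k x) * y + (-1) ^ k * (T.totalProj k x * T.dTotal y)) y (by simp)
      (fun y z hy hz => by
        rw [mul_add, map_add, hy, hz, map_add, mul_add, mul_add, mul_add]; abel)
      fun l y => ?_
    rw [totalProj_mul, dTotal_totalProj, dTotal_totalProj, dTotal_totalProj, totalProj_mul,
      totalProj_mul]
    have hm : UniversalForms.delta B x * (y : UniversalForms B) ∈
        UniversalForms.grade B (k + (l + 1)) := by
      have h := UniversalForms.mul_mem_grade (UniversalForms.delta_grade x.2).1 y.2
      rwa [show k + 1 + l = k + (l + 1) by omega] at h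
    have h1 : T.totalProj (k + 1 + l) ⟨_, UniversalForms.mul_mem_grade (deltaGrade B k x).2 y.2⟩ =
        T.totalProj (k + (l + 1)) ⟨UniversalForms.delta B x * y, hm⟩ :=
      T.totalProj_congr (by omega) _ _ rfl
    have h2 : ((-1) ^ k : ⨁ k, T.ConnesForm k) = algebraMap ℂ _ ((-1) ^ k) := by simp
    rw [h1, h2, ← Algebra.smul_def, ← map_smul, ← map_add]
    refine T.totalProj_congr rfl _ _ ?_
    change UniversalForms.delta B (x * y) = UniversalForms.delta B x * y +
      ((-1 : ℂ) ^ k) • (x * UniversalForms.delta B y)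
    rw [UniversalForms.leibniz x.2 y.2, Algebra.smul_def]
    simp
  generated := by
    intro R h0 hd
    rw [eq_top_iff]
    rintro x -
    refine T.total_induction (p := fun x => x ∈ R) x (zero_mem _)
      (fun x y hx hy => add_mem hx hy) ?_
    have hs : ∀ a : B, T.totalProj 1 ⟨_, UniversalForms.symb_mem_grade a⟩ ∈ R := fun a => by
      have := hd _ (h0 a)
      rw [inclTotal_apply, dTotal_totalProj] at this
      convert this using 1
      exact T.totalProj_congr rfl _ _ (UniversalForms.delta_incl a).symm
    have hp : ∀ (k : ℕ) (y : UniversalForms B), y ∈ LinearMap.range (UniversalForms.symb B) ^ k →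
        ∃ h : y ∈ UniversalForms.grade B k, T.totalProj k ⟨y, h⟩ ∈ R := by
      intro k
      induction k with
      | zero =>
        intro y hy
        rw [pow_zero, Submodule.mem_one] at hy
        obtain ⟨c, rfl⟩ := hy
        rw [← AlgHom.commutes (UniversalForms.incl B) c]
        exact ⟨_, h0 _⟩
      | succ k ih =>
        intro y hy
        rw [pow_succ] at hy
        refine Submodule.mul_induction_on hy ?_ ?_
        · rintro m hm _ ⟨a, rfl⟩
          obtain ⟨h, hR⟩ := ih m hm
          have h3 := mul_mem hR (hs a)
          rw [totalProj_mul] at h3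
          exact ⟨_, h3⟩
        · rintro x y ⟨h1, h2⟩ ⟨h3, h4⟩
          have h5 := add_mem h2 h4
          rw [← map_add] at h5
          exact ⟨_, h5⟩
    rintro k ⟨y, hy⟩
    have hA : ∃ h : y ∈ UniversalForms.grade B k, T.totalProj k ⟨y, h⟩ ∈ R := by
      refine Submodule.mul_induction_on hy ?_ ?_
      · rintro _ ⟨a, rfl⟩ m hm
        obtain ⟨h, hR⟩ := hp k m hm
        have h3 := mul_mem (h0 a) hR
        rw [inclTotal_apply, totalProj_mul] at h3
        have h4 : UniversalForms.incl B a * m ∈ UniversalForms.grade B k := by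
          simpa using UniversalForms.mul_mem_grade (UniversalForms.incl_mem_grade a) h
        refine ⟨h4, ?_⟩
        convert h3 using 1
        exact T.totalProj_congr (zero_add k).symm _ _ rfl
      · rintro x y ⟨h1, h2⟩ ⟨h3, h4⟩
        have h5 := add_mem h2 h4
        rw [← map_add] at h5
        exact ⟨_, h5⟩
    exact hA.2

variable {T} in
/-- The class in `Ω^k_D` of an operator `X ∈ Π(Ω^k)`, as a form of degree `k` of the calculus. -/
def formClass {k : ℕ} {X : H →L[ℂ] H} (hX : X ∈ T.opForms k) : T.connesCalculus.Form k :=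
  DifferentialCalculus.mkForm (C := T.connesCalculus)
    (DirectSum.lof ℂ ℕ T.ConnesForm k (T.cls k ⟨X, hX⟩)) ⟨_, rfl⟩

end DiracTriple

end Connes

/-! ### The Dirac operator `∑ ∂ᵢ ⊗ γᵢ` -/

section Dirac

/-- A faithful state. -/
structure IsFaithfulState {A : Type u} [CStarAlgebra A] [PartialOrder A] [StarOrderedRing A]
    (τ : A →ₚ[ℂ] ℂ) : Prop where
  map_one : τ 1 = 1
  faithful : ∀ a : A, τ (star a * a) = 0 → a = 0

/-- Gamma matrices: `γᵢ² = 1` and `γᵢ γⱼ = - γⱼ γᵢ` for `i ≠ j`. -/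
structure IsGammaFamily {n N : ℕ} (γ : Fin n → Matrix (Fin N) (Fin N) ℂ) : Prop where
  sq : ∀ i, γ i * γ i = 1
  anticomm : ∀ i j, i ≠ j → γ i * γ j = -(γ j * γ i)

variable {A : Type u} [CStarAlgebra A] [PartialOrder A] [StarOrderedRing A]

/-- The Hilbert space `L²(A, τ) ⊗ ℂ^N`, as the `ℓ²`-sum of `N` copies of the GNS space. -/
abbrev SpinorSpace (τ : A →ₚ[ℂ] ℂ) (N : ℕ) : Type u := PiLp 2 fun _ : Fin N => τ.GNS

/-- The operator `X ⊗ M` on `L²(A, τ) ⊗ ℂ^N`. -/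
def tensorOp {τ : A →ₚ[ℂ] ℂ} {N : ℕ} (X : τ.GNS →L[ℂ] τ.GNS) (M : Matrix (Fin N) (Fin N) ℂ) :
    SpinorSpace τ N →L[ℂ] SpinorSpace τ N :=
  (PiLp.continuousLinearEquiv 2 ℂ fun _ : Fin N => τ.GNS).symm.toContinuousLinearMap ∘L
    ContinuousLinearMap.pi fun j => ∑ k, M j k • (X ∘L PiLp.proj 2 (fun _ : Fin N => τ.GNS) k)

theorem tensorOp_apply {τ : A →ₚ[ℂ] ℂ} {N : ℕ} (X : τ.GNS →L[ℂ] τ.GNS)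
    (M : Matrix (Fin N) (Fin N) ℂ) (ξ : SpinorSpace τ N) (j : Fin N) :
    tensorOp X M ξ j = ∑ k, M j k • X (ξ k) := by
  simp [tensorOp]

theorem tensorOp_one_apply {τ : A →ₚ[ℂ] ℂ} {N : ℕ} (X : τ.GNS →L[ℂ] τ.GNS)
    (ξ : SpinorSpace τ N) (j : Fin N) : tensorOp X 1 ξ j = X (ξ j) := by
  simp [tensorOp_apply, Matrix.one_apply]

/-- The representation `a ↦ a ⊗ 1` of `A` on `L²(A, τ) ⊗ ℂ^N`. -/
def spinorRep (τ : A →ₚ[ℂ] ℂ) (N : ℕ) : A →⋆ₐ[ℂ] (SpinorSpace τ N →L[ℂ] SpinorSpace τ N) where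
  toFun a := tensorOp (τ.gnsStarAlgHom a) 1
  map_one' := by ext ξ j; simp [tensorOp_one_apply]
  map_mul' a b := by ext ξ j; simp [tensorOp_one_apply]
  map_zero' := by ext ξ j; simp [tensorOp_one_apply]
  map_add' a b := by ext ξ j; simp [tensorOp_one_apply]
  commutes' c := by
    ext ξ j
    simp [tensorOp_one_apply, Algebra.algebraMap_eq_smul_one]
  map_star' a := by
    refine (ContinuousLinearMap.eq_adjoint_iff _ _).2 fun ξ η => ?_
    simp only [PiLp.inner_apply, tensorOp_one_apply, map_star]
    refine Finset.sum_congr rfl fun j _ => ?_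
    rw [ContinuousLinearMap.star_eq_adjoint, ContinuousLinearMap.adjoint_inner_left]

/-- The class in `L²(A, τ)` of an element of `A`. -/
def toGNS (τ : A →ₚ[ℂ] ℂ) : A →ₗ[ℂ] τ.GNS :=
  (UniformSpace.Completion.toComplL (𝕜 := ℂ) (E := τ.PreGNS)).toLinearMap ∘ₗ τ.toPreGNS.toLinearMap

theorem gns_toGNS (τ : A →ₚ[ℂ] ℂ) (a b : A) : τ.gnsStarAlgHom a (toGNS τ b) = toGNS τ (a * b) := by
  simp [toGNS]

theorem IsFaithfulState.toGNS_injective {τ : A →ₚ[ℂ] ℂ} (hτ : IsFaithfulState τ) :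
    Function.Injective (toGNS τ) := by
  refine (injective_iff_map_eq_zero _).2 fun a ha => ?_
  have h : ‖τ.toPreGNS a‖ = 0 := by
    have h1 : ‖toGNS τ a‖ = 0 := by rw [ha, norm_zero]
    simpa [toGNS] using h1
  have h2 := τ.preGNS_norm_sq (τ.toPreGNS a)
  rw [h] at h2
  exact hτ.faithful a (by simpa using h2.symm)

theorem toGNS_norm_le (τ : A →ₚ[ℂ] ℂ) (a : A) : ‖toGNS τ a‖ ≤ ‖toGNS τ 1‖ * ‖a‖ := by
  have h : toGNS τ a = ((τ.leftMulMapPreGNS a (τ.toPreGNS 1) : τ.PreGNS) : τ.GNS) := by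
    simp [toGNS]
  rw [h, UniformSpace.Completion.norm_coe, mul_comm]
  have h1 : ‖toGNS τ 1‖ = ‖τ.toPreGNS 1‖ := by simp [toGNS]
  rw [h1]
  exact ContinuousLinearMap.le_of_opNorm_le _
    (LinearMap.mkContinuous_norm_le _ (norm_nonneg _) _) _

theorem toGNS_denseRange (τ : A →ₚ[ℂ] ℂ) : DenseRange (toGNS τ) := by
  have h : DenseRange ((↑) : τ.PreGNS → τ.GNS) := UniformSpace.Completion.denseRange_coe
  exact h.comp τ.toPreGNS.surjective.denseRange
    (UniformSpace.Completion.continuous_coe τ.PreGNS)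

variable (𝓐 : StarSubalgebra ℂ A)

/-- The embedding of `𝓐 ⊗ ℂ^N` in `L²(A, τ) ⊗ ℂ^N`. -/
def spinorEmbed (τ : A →ₚ[ℂ] ℂ) (N : ℕ) : (Fin N → 𝓐) →ₗ[ℂ] SpinorSpace τ N where
  toFun x := WithLp.toLp 2 fun j => toGNS τ (x j)
  map_add' x y := by ext j; simp
  map_smul' c x := by ext j; simp

@[simp] theorem spinorEmbed_apply (τ : A →ₚ[ℂ] ℂ) (N : ℕ) (x : Fin N → 𝓐) (j : Fin N) :
    spinorEmbed 𝓐 τ N x j = toGNS τ (x j) := rfl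

theorem IsFaithfulState.spinorEmbed_injective {τ : A →ₚ[ℂ] ℂ} (hτ : IsFaithfulState τ) (N : ℕ) :
    Function.Injective (spinorEmbed 𝓐 τ N) := by
  intro x y h
  ext j
  exact hτ.toGNS_injective (congrArg (fun ξ : SpinorSpace τ N => ξ j) h)

theorem spinorEmbed_dense (h𝓐 : 𝓐.topologicalClosure = ⊤) (τ : A →ₚ[ℂ] ℂ) (N : ℕ) :
    Dense (LinearMap.range (spinorEmbed 𝓐 τ N) : Set (SpinorSpace τ N)) := by
  have hd : DenseRange (fun a : 𝓐 => (a : A)) := by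
    intro a
    have : a ∈ 𝓐.topologicalClosure := by rw [h𝓐]; trivial
    have hr : Set.range (fun a : 𝓐 => (a : A)) = 𝓐 := Subtype.range_coe
    rw [hr]
    exact this
  have hc : Continuous (toGNS τ) :=
    (LinearMap.mkContinuous (toGNS τ) _ (toGNS_norm_le τ)).continuous
  have h1 : DenseRange (fun a : 𝓐 => toGNS τ a) := (toGNS_denseRange τ).comp hd hc
  have h2 : DenseRange (Pi.map fun _ : Fin N => fun a : 𝓐 => toGNS τ a) :=
    DenseRange.piMap fun _ => h1
  have h3 := (PiLp.continuousLinearEquiv 2 ℂ fun _ : Fin N => τ.GNS).symm.surjective.denseRange.comp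
    h2 (PiLp.continuousLinearEquiv 2 ℂ fun _ : Fin N => τ.GNS).symm.continuous
  exact h3

section

variable {A : Type u} [CStarAlgebra A] (𝓐 : StarSubalgebra ℂ A)

/-- The operator `∑ᵢ ∂ᵢ ⊗ γᵢ` on `𝓐 ⊗ ℂ^N`. -/
def diracAlg {n N : ℕ} (der : Fin n → (𝓐 →ₗ[ℂ] 𝓐)) (γ : Fin n → Matrix (Fin N) (Fin N) ℂ) :
    (Fin N → 𝓐) →ₗ[ℂ] (Fin N → 𝓐) :=
  LinearMap.pi fun j => ∑ i, ∑ k, γ i j k • (der i ∘ₗ LinearMap.proj k)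

theorem diracAlg_apply {n N : ℕ} (der : Fin n → (𝓐 →ₗ[ℂ] 𝓐))
    (γ : Fin n → Matrix (Fin N) (Fin N) ℂ) (x : Fin N → 𝓐) (j : Fin N) :
    diracAlg 𝓐 der γ x j = ∑ i, ∑ k, γ i j k • der i (x k) := by
  simp [diracAlg]

end

/-- The unbounded operator `∑ᵢ ∂ᵢ ⊗ γᵢ` on `L²(A, τ) ⊗ ℂ^N` with domain `𝓐 ⊗ ℂ^N`. -/
def diracOp {n N : ℕ} (der : Fin n → (𝓐 →ₗ[ℂ] 𝓐)) {τ : A →ₚ[ℂ] ℂ} (hτ : IsFaithfulState τ)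
    (γ : Fin n → Matrix (Fin N) (Fin N) ℂ) : SpinorSpace τ N →ₗ.[ℂ] SpinorSpace τ N where
  domain := LinearMap.range (spinorEmbed 𝓐 τ N)
  toFun := spinorEmbed 𝓐 τ N ∘ₗ diracAlg 𝓐 der γ ∘ₗ
    (LinearEquiv.ofInjective (spinorEmbed 𝓐 τ N) (hτ.spinorEmbed_injective 𝓐 N)).symm.toLinearMap

theorem diracOp_embed {n N : ℕ} (der : Fin n → (𝓐 →ₗ[ℂ] 𝓐)) {τ : A →ₚ[ℂ] ℂ}
    (hτ : IsFaithfulState τ) (γ : Fin n → Matrix (Fin N) (Fin N) ℂ) (x : Fin N → 𝓐)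
    (y : (diracOp 𝓐 der hτ γ).domain) (hy : (y : SpinorSpace τ N) = spinorEmbed 𝓐 τ N x) :
    diracOp 𝓐 der hτ γ y = spinorEmbed 𝓐 τ N (diracAlg 𝓐 der γ x) := by
  have h : (LinearEquiv.ofInjective (spinorEmbed 𝓐 τ N)
      (hτ.spinorEmbed_injective 𝓐 N)).symm y = x := by
    exact (LinearEquiv.symm_apply_eq _).2 (Subtype.ext hy)
  change spinorEmbed 𝓐 τ N (diracAlg 𝓐 der γ ((LinearEquiv.ofInjective (spinorEmbed 𝓐 τ N)
      (hτ.spinorEmbed_injective 𝓐 N)).symm y)) = _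
  rw [h]

theorem spinorRep_embed (τ : A →ₚ[ℂ] ℂ) (N : ℕ) (a : 𝓐) (x : Fin N → 𝓐) :
    spinorRep τ N a (spinorEmbed 𝓐 τ N x) = spinorEmbed 𝓐 τ N (fun j => a * x j) := by
  ext j
  change tensorOp (τ.gnsStarAlgHom a) 1 (spinorEmbed 𝓐 τ N x) j = _
  rw [tensorOp_one_apply, spinorEmbed_apply, gns_toGNS]
  rfl

/-- The Dirac triple `(𝓐, L²(A, τ) ⊗ ℂ^N, ∑ᵢ ∂ᵢ ⊗ γᵢ)`. -/
def diracTriple {n N : ℕ} [NeZero N] (h𝓐 : 𝓐.topologicalClosure = ⊤)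
    (der : Fin n → (𝓐 →ₗ[ℂ] 𝓐)) (hder : ∀ i a b, der i (a * b) = der i a * b + a * der i b)
    {τ : A →ₚ[ℂ] ℂ} (hτ : IsFaithfulState τ) (γ : Fin n → Matrix (Fin N) (Fin N) ℂ) :
    DiracTriple 𝓐 (SpinorSpace τ N) where
  π := (spinorRep τ N).comp 𝓐.subtype
  faithful := by
    refine (injective_iff_map_eq_zero _).2 fun a ha => ?_
    have h1 : spinorEmbed 𝓐 τ N (fun _ => a * 1) = 0 := by
      rw [← spinorRep_embed 𝓐 τ N a (fun _ => 1)]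
      have h2 : spinorRep τ N (a : A) = 0 := ha
      rw [h2]; rfl
    have h3 := hτ.spinorEmbed_injective 𝓐 N (h1.trans (map_zero _).symm)
    simpa using congrFun h3 0
  D := diracOp 𝓐 der hτ γ
  dense := spinorEmbed_dense 𝓐 h𝓐 τ N
  domain_mem := by
    rintro a _ ⟨x, rfl⟩
    exact ⟨_, (spinorRep_embed 𝓐 τ N a x).symm⟩
  bounded := by
    intro a
    refine ⟨∑ i, tensorOp (τ.gnsStarAlgHom (der i a : A)) (γ i), ?_⟩
    rintro ⟨_, ⟨x, rfl⟩⟩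
    rw [diracOp_embed 𝓐 der hτ γ (fun j => a * x j) _ (spinorRep_embed 𝓐 τ N a x),
      diracOp_embed 𝓐 der hτ γ x _ rfl]
    change _ = _ - spinorRep τ N (a : A) _
    rw [spinorRep_embed, ← map_sub]
    ext j
    have h : (diracAlg 𝓐 der γ (fun j => a * x j) - fun j => a * diracAlg 𝓐 der γ x j) j =
        ∑ i, ∑ k, γ i j k • (der i a * x k) := by
      simp only [Pi.sub_apply, diracAlg_apply, hder, smul_add, Finset.sum_add_distrib,
        Finset.mul_sum, mul_smul_comm, add_sub_cancel_right]
    rw [spinorEmbed_apply, h]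
    simp only [sum_apply, WithLp.ofLp_sum, Finset.sum_apply, tensorOp_apply,
      spinorEmbed_apply, gns_toGNS]
    simp

end Dirac

section Generated

variable {A : Type u} [CStarAlgebra A] {n : ℕ} (S : Fin n → A)

/-- The `*`-subalgebra generated by a family of elements. -/
abbrev generatedAlgebra : StarSubalgebra ℂ A := StarAlgebra.adjoin ℂ (Set.range S)

/-- The generators as elements of the `*`-subalgebra that they generate. -/
def generator (i : Fin n) : generatedAlgebra S :=
  ⟨S i, StarAlgebra.subset_adjoin ℂ _ (Set.mem_range_self i)⟩

end Generated

end

/-!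
Write `Γᵢ = 1 ⊗ γᵢ` and let `π` be the representation `a ↦ a ⊗ 1`. The `Γᵢ` commute with `π` and
satisfy the Clifford relations, and `[D, π a] = ∑ᵢ π (∂ᵢ a) Γᵢ`. The computation of Connes' forms
uses only these facts, the isometry relations, and the commutation of the derivations, which hold
because `[∂ᵢ, ∂ⱼ]` is a derivation that vanishes on the generators; they are collected in
`DiracTriple.IsCliffordType`.

*One-forms.* Since `Sᵢ* [D, π Sᵢ] = Γᵢ`, the space `Π(Ω¹)` consists of the operators
`∑ᵢ π (aᵢ) Γᵢ`. The coefficients are unique, because the anticommutator with `Γᵣ` returns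
`2 π (aᵣ)`, and there is no junk in degree one, as `π` is faithful.

*Two-forms.* `Π(Ω²)` consists of the operators `∑ᵢⱼ π (cᵢⱼ) Γᵢ Γⱼ`. Commuting such an operator with
`Γᵣ` and using the uniqueness of the coefficients of one-forms shows that it determines the
antisymmetric part of `c`. If `ω` is a universal one-form represented by `∑ᵢ π (aᵢ) Γᵢ`, then `δ ω`
is represented by an operator of this shape with antisymmetric part `∂ₚ a_q - ∂_q aₚ`
(`exists_rep_delta`). So a junk form has symmetric coefficients, that is, lies in `π(𝓐)`.
Conversely `Sᵢ*² δ(Sᵢ²) - 2 Sᵢ* δ Sᵢ` is represented by `0` and its differential by `-2`, so all of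
`π(𝓐)` is junk when `n > 0` (`one_mem_junk`). Hence the `eₚ ∧ e_q` with `p < q` form a basis, the
`eᵢ` anticommute, and `d (∑ᵢ eᵢ aᵢ) = ∑_{p < q} eₚ ∧ e_q (∂ₚ a_q - ∂_q aₚ)`.

*Tameness and the metric.* In a calculus with a central basis of one-forms, `Ω¹ ⊗ Ω¹` is free on
the `eᵢ ⊗ eⱼ`, and `P` is the symmetrization of coordinates (`isTame_symmetrization`,
`isBilinearMetric_canonicalMetric`).

A faithful state exists because the C*-algebra is separable (`exists_isFaithfulState`), and gamma
matrices are built from Pauli matrices by Kronecker products (`exists_isGammaFamily`).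
-/

/-! ### Faithful states on separable C*-algebras -/

section FaithfulState

/-- A convex combination, with all weights positive, of a sequence of functionals that have norm at
most one and value one at the unit. -/
theorem exists_convexCombination {A : Type*} [CStarAlgebra A] {g : ℕ → A →L[ℂ] ℂ} (hg : ∀ k, ‖g k‖ ≤ 1)
    (h1 : ∀ k, g k 1 = 1) :
    ∃ (c : ℕ → ℝ) (G : A →L[ℂ] ℂ), (∀ k, 0 < c k) ∧ ‖G‖ ≤ 1 ∧ G 1 = 1 ∧
      ∀ a, HasSum (fun k => (c k : ℂ) * g k a) (G a) := by
  obtain ⟨c, hc, hsum⟩ : ∃ c : ℕ → ℝ, (∀ k, 0 < c k) ∧ HasSum c 1 :=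
    ⟨fun k => (1 : ℝ) / 2 / 2 ^ k, fun k => by positivity, hasSum_geometric_two' 1⟩
  have hb : ∀ k, ‖(c k : ℂ) • g k‖ ≤ c k := fun k => by
    rw [norm_smul, Complex.norm_real, Real.norm_of_nonneg (hc k).le]
    exact mul_le_of_le_one_right (hc k).le (hg k)
  obtain ⟨G, hS⟩ := Summable.of_norm_bounded hsum.summable hb
  have hG : ∀ a, HasSum (fun k => (c k : ℂ) * g k a) (G a) := fun a =>
    hS.mapL (ContinuousLinearMap.apply ℂ ℂ a)
  refine ⟨c, G, hc, hS.norm_le_of_bounded hsum hb, (hG 1).unique ?_, hG⟩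
  simpa [h1] using Complex.hasSum_ofReal.2 hsum

variable {A : Type*} [CStarAlgebra A] [PartialOrder A] [StarOrderedRing A]

/-- A functional of norm at most one with value one at the unit has nonnegative real part on
positive elements, because `a ≥ 0` lies in the ball of radius `‖a‖` around `‖a‖ • 1`. -/
theorem re_apply_nonneg_of_norm_le_one {g : A →L[ℂ] ℂ} (hg : ‖g‖ ≤ 1) (h1 : g 1 = 1)
    {a : A} (ha : 0 ≤ a) : 0 ≤ (g a).re := by
  have hle : a ≤ algebraMap ℝ A ‖a‖ := IsSelfAdjoint.le_algebraMap_norm_self (.of_nonneg ha)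
  have hn : ‖algebraMap ℝ A ‖a‖ - a‖ ≤ ‖a‖ :=
    (CStarAlgebra.norm_le_iff_le_algebraMap _ (norm_nonneg a) (sub_nonneg.2 hle)).2
      (sub_le_self _ ha)
  have hb : ‖g (algebraMap ℝ A ‖a‖ - a)‖ ≤ ‖a‖ :=
    (g.le_of_opNorm_le hg _).trans (by rwa [one_mul])
  have hv : g (algebraMap ℝ A ‖a‖) = (‖a‖ : ℂ) := by
    rw [IsScalarTower.algebraMap_apply ℝ ℂ A, Algebra.algebraMap_eq_smul_one, map_smul, h1]
    simp
  rw [map_sub, hv] at hb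
  have hr := (Complex.re_le_norm _).trans hb
  simpa using hr

/-- A positive element is normed by a functional of norm at most one with value one at the unit:
extend a character of the C*-algebra generated by the element. -/
theorem exists_functional_apply_eq_norm [Nontrivial A] {b : A} (hb : 0 ≤ b) :
    ∃ g : A →L[ℂ] ℂ, ‖g‖ ≤ 1 ∧ g 1 = 1 ∧ g b = ‖b‖ := by
  have hsa : IsSelfAdjoint b := .of_nonneg hb
  have : IsStarNormal b := hsa.isStarNormal
  have hs : (‖b‖ : ℂ) ∈ spectrum ℂ b :=
    spectrum.algebraMap_mem ℂ (CStarAlgebra.norm_mem_spectrum_of_nonneg hb)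
  obtain ⟨φ, hφ⟩ := (StarAlgebra.elemental.bijective_characterSpaceToSpectrum b).2 ⟨_, hs⟩
  have hφb : φ ⟨b, StarAlgebra.elemental.self_mem ℂ b⟩ = ‖b‖ := congrArg Subtype.val hφ
  let p : Submodule ℂ A := Subalgebra.toSubmodule (StarAlgebra.elemental ℂ b).toSubalgebra
  let φ' : StarAlgebra.elemental ℂ b →ₐ[ℂ] ℂ := WeakDual.CharacterSpace.toAlgHom φ
  let l : p →ₗ[ℂ] ℂ := φ'.toLinearMap
  have hbd : ∀ x : p, ‖l x‖ ≤ 1 * ‖x‖ := fun x => by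
    rw [one_mul]
    exact AlgHom.norm_apply_le_self φ' (⟨x.1, x.2⟩ : StarAlgebra.elemental ℂ b)
  obtain ⟨g, hg, hn⟩ := exists_extension_norm_eq p (l.mkContinuous 1 hbd)
  refine ⟨g, ?_, ?_, ?_⟩
  · rw [hn]
    exact LinearMap.mkContinuous_norm_le _ zero_le_one _
  · exact (hg (⟨1, one_mem (StarAlgebra.elemental ℂ b)⟩ : p)).trans (map_one φ')
  · exact (hg (⟨b, StarAlgebra.elemental.self_mem ℂ b⟩ : p)).trans hφb

/-- The positive functional `a ↦ (g a + conj (g (star a))) / 2`. -/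
noncomputable def symmetrizedFunctional {g : A →L[ℂ] ℂ} (hg : ‖g‖ ≤ 1) (h1 : g 1 = 1) :
    A →ₚ[ℂ] ℂ :=
  PositiveLinearMap.mk₀
    { toFun := fun a => (1 / 2 : ℂ) * (g a + star (g (star a)))
      map_add' := fun a b => by simp only [star_add, map_add]; ring
      map_smul' := fun c a => by
        simp only [star_smul, map_smul, smul_eq_mul, star_mul, star_star, RingHom.id_apply]
        ring }
    (fun a ha => by
      have hr := re_apply_nonneg_of_norm_le_one hg h1 ha
      have hsa : star a = a := (IsSelfAdjoint.of_nonneg ha).star_eq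
      change 0 ≤ (1 / 2 : ℂ) * (g a + star (g (star a)))
      rw [hsa, Complex.star_def, Complex.add_conj]
      have h2 : (1 / 2 : ℂ) * ((2 * (g a).re : ℝ) : ℂ) = ((g a).re : ℂ) := by push_cast; ring
      rw [h2]
      exact Complex.zero_le_real.2 hr)

theorem symmetrizedFunctional_apply {g : A →L[ℂ] ℂ} (hg : ‖g‖ ≤ 1) (h1 : g 1 = 1) (a : A) :
    symmetrizedFunctional hg h1 a = (1 / 2 : ℂ) * (g a + star (g (star a))) := rfl

/-- A separable C*-algebra has a faithful state: a convex combination of countably many states,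
the `k`-th of which attains the norm at `star (x k) * x k` for a dense sequence `x`. -/
theorem exists_isFaithfulState [Nontrivial A] [TopologicalSpace.SeparableSpace A] :
    ∃ τ : A →ₚ[ℂ] ℂ, IsFaithfulState τ := by
  obtain ⟨x, hx⟩ := TopologicalSpace.exists_dense_seq A
  choose g hg hg1 hgx using fun k => exists_functional_apply_eq_norm (star_mul_self_nonneg (x k))
  obtain ⟨c, G, hc, hGn, hG1, hG⟩ := exists_convexCombination hg hg1
  refine ⟨symmetrizedFunctional hGn hG1, ?_, fun a ha => ?_⟩
  · rw [symmetrizedFunctional_apply, star_one, hG1, star_one]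
    norm_num
  have hre : (G (star a * a)).re = 0 := by
    have := congrArg Complex.re ha
    rw [symmetrizedFunctional_apply, star_mul, star_star, Complex.star_def,
      Complex.add_conj] at this
    simpa using this
  have hk : ∀ k, (g k (star a * a)).re = 0 := by
    have h1 := Complex.hasSum_re (hG (star a * a))
    rw [hre] at h1
    have hn : ∀ k, 0 ≤ c k * (g k (star a * a)).re := fun k =>
      mul_nonneg (hc k).le (re_apply_nonneg_of_norm_le_one (hg k) (hg1 k) (star_mul_self_nonneg a))
    have h2 : HasSum (fun k => c k * (g k (star a * a)).re) 0 := by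
      simpa only [Complex.re_ofReal_mul] using h1
    intro k
    have h3 := congrFun ((hasSum_zero_iff_of_nonneg hn).1 h2) k
    exact (mul_eq_zero.1 h3).resolve_left (hc k).ne'
  -- the closed condition `‖y* y‖ ≤ ‖y* y - a* a‖` holds on the dense sequence, hence at `y = a`
  have hcl : IsClosed {y : A | ‖star y * y‖ ≤ ‖star y * y - star a * a‖} :=
    isClosed_le (by fun_prop) (by fun_prop)
  have hmem : ∀ k, x k ∈ {y : A | ‖star y * y‖ ≤ ‖star y * y - star a * a‖} := fun k => by
    have h1 : (g k (star (x k) * x k - star a * a)).re = ‖star (x k) * x k‖ := by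
      rw [map_sub, Complex.sub_re, hk, hgx, Complex.ofReal_re, sub_zero]
    calc ‖star (x k) * x k‖ = (g k (star (x k) * x k - star a * a)).re := h1.symm
      _ ≤ ‖g k (star (x k) * x k - star a * a)‖ := Complex.re_le_norm _
      _ ≤ 1 * ‖star (x k) * x k - star a * a‖ := (g k).le_of_opNorm_le (hg k) _
      _ = _ := one_mul _
  have ha' : a ∈ {y : A | ‖star y * y‖ ≤ ‖star y * y - star a * a‖} :=
    hcl.closure_subset_iff.2 (Set.range_subset_iff.2 hmem) (hx a)
  have h0 : ‖star a * a‖ ≤ ‖star a * a - star a * a‖ := ha'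
  rw [sub_self, norm_zero] at h0
  exact (CStarRing.star_mul_self_eq_zero_iff a).1 (norm_le_zero_iff.1 h0)

end FaithfulState

/-- A C*-algebra generated by a countable set is separable. -/
theorem separableSpace_of_topologicalClosure_adjoin_eq_top {A : Type*} [CStarAlgebra A]
    {s : Set A} (hs : s.Countable) (h : (StarAlgebra.adjoin ℂ s).topologicalClosure = ⊤) :
    TopologicalSpace.SeparableSpace A := by
  have hM : (Submonoid.closure (s ∪ star s) : Set A).Countable := by
    have : Countable ↥(s ∪ star s) := by
      have h2 : (star s).Countable := by
        rw [← Set.image_star]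
        exact hs.image _
      exact (hs.union h2).to_subtype
    rw [Submonoid.closure_eq_mrange]
    have : Countable (FreeMonoid ↥(s ∪ star s)) := inferInstanceAs (Countable (List _))
    exact Set.countable_range _
  have hsp := hM.isSeparable.span (R := ℂ)
  rw [← TopologicalSpace.isSeparable_univ_iff]
  refine hsp.closure.mono fun a _ => ?_
  have ha : a ∈ (StarAlgebra.adjoin ℂ s).topologicalClosure := by rw [h]; trivial
  rw [← SetLike.mem_coe, StarSubalgebra.topologicalClosure_coe] at ha
  have he : (Submodule.span ℂ (Submonoid.closure (s ∪ star s) : Set A) : Set A) =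
      StarAlgebra.adjoin ℂ s := by
    rw [← StarAlgebra.adjoin_eq_span]; rfl
  rwa [he]

/-! ### Existence of gamma matrices -/

section Gamma

open scoped Kronecker

/-- Gamma matrices of size `2 ^ ⌊n / 2⌋`. The step from `n` to `n + 2` replaces `γᵢ` by `γᵢ ⊗ σ₃`
and adjoins `1 ⊗ σ₁` and `1 ⊗ σ₂`, with the Pauli matrices `σ₁, σ₂, σ₃`. -/
theorem exists_isGammaFamily (n : ℕ) :
    ∃ γ : Fin n → Matrix (Fin (2 ^ (n / 2))) (Fin (2 ^ (n / 2))) ℂ, IsGammaFamily γ := by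
  induction n using Nat.twoStepInduction with
  | zero => exact ⟨fun _ => 1, fun i => i.elim0, fun i => i.elim0⟩
  | one => exact ⟨fun _ => 1, fun _ => one_mul 1, fun i j h => (h (Subsingleton.elim i j)).elim⟩
  | more n ih _ =>
    obtain ⟨γ, hγ⟩ := ih
    let σ₁ : Matrix (Fin 2) (Fin 2) ℂ := !![0, 1; 1, 0]
    let σ₂ : Matrix (Fin 2) (Fin 2) ℂ := !![0, -Complex.I; Complex.I, 0]
    let σ₃ : Matrix (Fin 2) (Fin 2) ℂ := !![1, 0; 0, -1]
    have s1 : σ₁ * σ₁ = 1 := by simp [σ₁, Matrix.one_fin_two]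
    have s2 : σ₂ * σ₂ = 1 := by simp [σ₂, Matrix.one_fin_two]
    have s3 : σ₃ * σ₃ = 1 := by simp [σ₃, Matrix.one_fin_two]
    have s12 : σ₁ * σ₂ = -(σ₂ * σ₁) := by simp [σ₁, σ₂]
    have s13 : σ₁ * σ₃ = -(σ₃ * σ₁) := by simp [σ₁, σ₃]
    have s23 : σ₂ * σ₃ = -(σ₃ * σ₂) := by simp [σ₂, σ₃]
    have hneg : ∀ (X : Matrix (Fin (2 ^ (n / 2))) (Fin (2 ^ (n / 2))) ℂ)
        (Y : Matrix (Fin 2) (Fin 2) ℂ), X ⊗ₖ (-Y) = -(X ⊗ₖ Y) := fun X Y => by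
      ext i j; simp [Matrix.kroneckerMap_apply]
    have hneg' : ∀ (X : Matrix (Fin (2 ^ (n / 2))) (Fin (2 ^ (n / 2))) ℂ)
        (Y : Matrix (Fin 2) (Fin 2) ℂ), (-X) ⊗ₖ Y = -(X ⊗ₖ Y) := fun X Y => by
      ext i j; simp [Matrix.kroneckerMap_apply]
    have hcard : 2 ^ (n / 2) * 2 = 2 ^ ((n + 2) / 2) := by
      rw [Nat.add_div_right n two_pos, pow_succ]
    let e : Fin (2 ^ (n / 2)) × Fin 2 ≃ Fin (2 ^ ((n + 2) / 2)) :=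
      finProdFinEquiv.trans (finCongr hcard)
    let E := Matrix.reindexAlgEquiv ℂ ℂ e
    let δ : Fin (n + 2) → Matrix (Fin (2 ^ (n / 2)) × Fin 2) (Fin (2 ^ (n / 2)) × Fin 2) ℂ :=
      Fin.cons (1 ⊗ₖ σ₁) (Fin.cons (1 ⊗ₖ σ₂) fun i => γ i ⊗ₖ σ₃)
    have hsq : ∀ i, δ i * δ i = 1 := by
      refine Fin.cases ?_ (Fin.cases ?_ fun i => ?_)
      · simp [δ, ← Matrix.mul_kronecker_mul, s1]
      · simp [δ, ← Matrix.mul_kronecker_mul, s2]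
      · simp [δ, ← Matrix.mul_kronecker_mul, s3, hγ.sq]
    have hanti : ∀ i j, i ≠ j → δ i * δ j = -(δ j * δ i) := by
      refine Fin.cases ?_ (Fin.cases ?_ fun i => ?_) <;>
        refine Fin.cases ?_ (Fin.cases ?_ fun j => ?_) <;> intro hij
      · exact (hij rfl).elim
      · simp [δ, ← Matrix.mul_kronecker_mul, s12, hneg]
      · simp [δ, ← Matrix.mul_kronecker_mul, s13, hneg]
      · simp [δ, ← Matrix.mul_kronecker_mul, s12, hneg]
      · exact (hij rfl).elim
      · simp [δ, ← Matrix.mul_kronecker_mul, s23, hneg]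
      · simp [δ, ← Matrix.mul_kronecker_mul, s13, hneg]
      · simp [δ, ← Matrix.mul_kronecker_mul, s23, hneg]
      · have h : i ≠ j := fun h => hij (by rw [h])
        simp [δ, ← Matrix.mul_kronecker_mul, hγ.anticomm i j h, hneg']
    refine ⟨fun i => E (δ i), fun i => ?_, fun i j hij => ?_⟩
    · rw [← map_mul, hsq, map_one]
    · rw [← map_mul, ← map_mul, hanti i j hij, map_neg]

end Gamma

/-! ### Double sums over pairs of indices -/

/-- A double sum split along the diagonal. -/
theorem sum_sum_eq_sum_diag_add {M : Type*} [AddCommMonoid M] {n : ℕ} (f : Fin n → Fin n → M) :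
    ∑ i, ∑ j, f i j = ∑ i, f i i +
      ∑ p : {p : Fin n × Fin n // p.1 < p.2}, (f p.1.1 p.1.2 + f p.1.2 p.1.1) := by
  have hlt : ∀ g : Fin n → Fin n → M, ∑ p : {p : Fin n × Fin n // p.1 < p.2}, g p.1.1 p.1.2 =
      ∑ i, ∑ j, if i < j then g i j else 0 := fun g => by
    rw [← Fintype.sum_prod_type' (f := fun i j => if i < j then g i j else 0),
      ← Finset.sum_filter]
    exact (Finset.sum_subtype (Finset.univ.filter fun p : Fin n × Fin n => p.1 < p.2)
      (by simp) fun p => g p.1 p.2).symm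
  have hdiag : ∑ i, f i i = ∑ i, ∑ j, if i = j then f i j else 0 := by simp
  rw [Finset.sum_add_distrib, hlt f, hlt fun i j => f j i,
    Finset.sum_comm (f := fun i j => if i < j then f j i else 0), hdiag,
    ← Finset.sum_add_distrib, ← Finset.sum_add_distrib]
  refine Finset.sum_congr rfl fun i _ => ?_
  rw [← Finset.sum_add_distrib, ← Finset.sum_add_distrib]
  refine Finset.sum_congr rfl fun j _ => ?_
  rcases lt_trichotomy i j with h | h | h
  · simp [h, h.ne, h.not_gt]
  · simp [h]
  · simp [h, h.ne', h.not_gt]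

/-! ### Calculi with a central basis of one-forms -/

namespace DifferentialCalculus

open MulOpposite (op unop)

variable {B : Type*} [Ring B] [Algebra ℂ B] {C : DifferentialCalculus B}

theorem complex_smul_eq_op_smul (k : ℕ) (c : ℂ) (x : C.Form k) :
    c • x = op (algebraMap ℂ B c) • x :=
  form_ext (by
    rw [map_smul, coe_right_smul, MulOpposite.unop_op, AlgHom.commutes, Algebra.smul_def,
      Algebra.commutes])

variable {n : ℕ} (b : Module.Basis (Fin n) Bᵐᵒᵖ (C.Form 1))

/-- The coordinate `xᵢ ∈ B` of a one-form `x = ∑ᵢ eᵢ xᵢ`. -/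
noncomputable def coordForm (i : Fin n) : C.Form 1 →ₗ[ℂ] B where
  toFun x := (b.repr x i).unop
  map_add' x y := by simp
  map_smul' c x := by
    rw [complex_smul_eq_op_smul, map_smul, Finsupp.smul_apply, smul_eq_mul, MulOpposite.unop_mul,
      MulOpposite.unop_op, RingHom.id_apply, ← Algebra.commutes, Algebra.smul_def]

theorem coordForm_apply (i : Fin n) (x : C.Form 1) : coordForm b i x = (b.repr x i).unop := rfl

theorem sum_coordForm (x : C.Form 1) : ∑ i, op (coordForm b i x) • b i = x := b.sum_repr x

theorem coordForm_right_smul (i : Fin n) (a : B) (x : C.Form 1) :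
    coordForm b i (op a • x) = coordForm b i x * a := by
  simp [coordForm_apply]

theorem coordForm_sum (a : Fin n → B) (i : Fin n) :
    coordForm b i (∑ j, op (a j) • b j) = a i := by
  have h := congrFun (b.repr_sum_self fun j => op (a j)) i
  rw [coordForm_apply, h, MulOpposite.unop_op]

theorem coordForm_basis (i j : Fin n) : coordForm b i (b j) = if i = j then 1 else 0 := by
  rw [coordForm_apply, Module.Basis.repr_self, Finsupp.single_apply]
  simp only [eq_comm (a := j)]
  split_ifs <;> rfl

theorem ext_coordForm {x y : C.Form 1} (h : ∀ i, coordForm b i x = coordForm b i y) : x = y := by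
  rw [← sum_coordForm b x, ← sum_coordForm b y]
  simp only [h]

variable {b} (hb : ∀ i, b i ∈ C.center)

include hb in
theorem coordForm_left_smul (i : Fin n) (a : B) (x : C.Form 1) :
    coordForm b i (a • x) = a * coordForm b i x := by
  have h : a • x = ∑ j, op (a * coordForm b j x) • b j := by
    conv_lhs => rw [← sum_coordForm b x]
    rw [Finset.smul_sum]
    refine Finset.sum_congr rfl fun j _ => ?_
    rw [smul_comm, hb j a, smul_smul, ← MulOpposite.op_mul]
  rw [h, coordForm_sum]

include hb in
/-- For a central basis the central one-forms are those with central coordinates. -/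
theorem coordForm_mem_center {x : C.Form 1} (hx : x ∈ C.center) (i : Fin n) :
    coordForm b i x ∈ Subalgebra.center ℂ B := by
  refine Subalgebra.mem_center_iff.2 fun a => ?_
  rw [← coordForm_left_smul hb, hx a, coordForm_right_smul]

/-! ### The balanced tensor square in coordinates -/

/-- The coordinate `tᵢⱼ ∈ B` of `t = ∑ᵢⱼ eᵢ ⊗ eⱼ tᵢⱼ`. -/
noncomputable def coordTensor (i j : Fin n) : C.Tensor2 →ₗ[ℂ] B :=
  C.descend
    (TensorProduct.lift ((LinearMap.mul ℂ B).compl₁₂ (coordForm b i) (coordForm b j)))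
    (fun x y a => by
      simp [coordForm_right_smul, coordForm_left_smul hb, mul_assoc])

theorem coordTensor_tmul (i j : Fin n) (x y : C.Form 1) :
    coordTensor hb i j (tmul x y) = coordForm b i x * coordForm b j y := rfl

theorem tensor2_induction {p : C.Tensor2 → Prop} (t : C.Tensor2) (h0 : p 0)
    (hadd : ∀ x y, p x → p y → p (x + y)) (h : ∀ x y, p (tmul x y)) : p t := by
  obtain ⟨t, rfl⟩ := C.toTensor2_surjective t
  induction t with
  | zero => rwa [map_zero]
  | tmul x y => exact h x y
  | add x y hx hy => rw [map_add]; exact hadd _ _ hx hy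

theorem coordTensor_right_smul (i j : Fin n) (a : Bᵐᵒᵖ) (t : C.Tensor2) :
    coordTensor hb i j (a • t) = coordTensor hb i j t * a.unop := by
  refine tensor2_induction (p := fun t => coordTensor hb i j (a • t) =
    coordTensor hb i j t * a.unop) t (by simp) (fun x y hx hy => ?_) fun x y => ?_
  · rw [smul_add, map_add, map_add, hx, hy, add_mul]
  · rw [right_smul_tmul, coordTensor_tmul, coordTensor_tmul, ← MulOpposite.op_unop a,
      coordForm_right_smul, MulOpposite.unop_op, mul_assoc]

theorem coordTensor_left_smul (i j : Fin n) (a : B) (t : C.Tensor2) :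
    coordTensor hb i j (a • t) = a * coordTensor hb i j t := by
  refine tensor2_induction (p := fun t => coordTensor hb i j (a • t) =
    a * coordTensor hb i j t) t (by simp) (fun x y hx hy => ?_) fun x y => ?_
  · rw [smul_add, map_add, map_add, hx, hy, mul_add]
  · rw [left_smul_tmul, coordTensor_tmul, coordTensor_tmul, coordForm_left_smul hb, mul_assoc]

theorem sum_tmul {κ : Type*} (s : Finset κ) (f : κ → C.Form 1) (y : C.Form 1) :
    tmul (∑ k ∈ s, f k) y = ∑ k ∈ s, tmul (f k) y := by
  simp only [tmul, TensorProduct.sum_tmul, map_sum]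

theorem tmul_sum {κ : Type*} (s : Finset κ) (f : κ → C.Form 1) (x : C.Form 1) :
    tmul x (∑ k ∈ s, f k) = ∑ k ∈ s, tmul x (f k) := by
  simp only [tmul, TensorProduct.tmul_sum, map_sum]

include hb in
theorem tmul_op_smul_basis (i j : Fin n) (a c : B) :
    tmul (op a • b i) (op c • b j) = op (a * c) • tmul (b i) (b j) := by
  rw [tmul_balance, smul_comm, hb j a, smul_smul, ← MulOpposite.op_mul, right_smul_tmul]

theorem sum_coordTensor (t : C.Tensor2) :
    ∑ i, ∑ j, op (coordTensor hb i j t) • tmul (b i) (b j) = t := by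
  refine tensor2_induction (p := fun t => ∑ i, ∑ j, op (coordTensor hb i j t) • tmul (b i) (b j)
    = t) t (by simp) (fun x y hx hy => ?_) fun x y => ?_
  · simp only [map_add, MulOpposite.op_add, add_smul, Finset.sum_add_distrib, hx, hy]
  · conv_rhs => rw [← sum_coordForm b x, ← sum_coordForm b y]
    simp only [sum_tmul, tmul_sum, tmul_op_smul_basis hb, coordTensor_tmul]
    exact Finset.sum_comm

/-- The balanced tensor square is free with basis `eᵢ ⊗ eⱼ`. -/
noncomputable def tensorEquiv : C.Tensor2 ≃ₗ[Bᵐᵒᵖ] (Fin n → Fin n → B) where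
  toFun t i j := coordTensor hb i j t
  map_add' s t := by ext i j; simp
  map_smul' a t := by ext i j; simp [coordTensor_right_smul]
  invFun f := ∑ i, ∑ j, op (f i j) • tmul (b i) (b j)
  left_inv t := sum_coordTensor hb t
  right_inv f := by
    ext i j
    simp only [map_sum, coordTensor_right_smul, coordTensor_tmul, coordForm_basis]
    simp

/-! ### The symmetrization and the metric -/

/-- `f ↦ (f + fᵀ) / 2` on coordinates. -/
noncomputable def symmetrizeCoord (B : Type*) [Ring B] [Algebra ℂ B] (n : ℕ) :
    (Fin n → Fin n → B) →ₗ[Bᵐᵒᵖ] (Fin n → Fin n → B) where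
  toFun f i j := (1 / 2 : ℂ) • (f i j + f j i)
  map_add' f g := by
    ext i j
    simp only [Pi.add_apply, ← smul_add]
    congr 1
    abel
  map_smul' a f := by
    ext i j
    simp

/-- The idempotent `P (eᵢ ⊗ eⱼ) = (eᵢ ⊗ eⱼ + eⱼ ⊗ eᵢ) / 2`. -/
noncomputable def symmetrization : C.Tensor2 →ₗ[Bᵐᵒᵖ] C.Tensor2 :=
  (tensorEquiv hb).symm.toLinearMap ∘ₗ symmetrizeCoord B n ∘ₗ (tensorEquiv hb).toLinearMap

theorem coordTensor_symmetrization (i j : Fin n) (t : C.Tensor2) :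
    coordTensor hb i j (symmetrization hb t) =
      (1 / 2 : ℂ) • (coordTensor hb i j t + coordTensor hb j i t) :=
  congrFun (congrFun ((tensorEquiv hb).apply_symm_apply
    (symmetrizeCoord B n (tensorEquiv hb t))) i) j

theorem ext_coordTensor {s t : C.Tensor2}
    (h : ∀ i j, coordTensor hb i j s = coordTensor hb i j t) : s = t :=
  (tensorEquiv hb).injective (by ext i j; exact h i j)

theorem half_smul_add_self (a : B) : (1 / 2 : ℂ) • (a + a) = a := by
  rw [← two_smul ℂ a, smul_smul]
  norm_num

theorem symmetrization_eq_self_iff (t : C.Tensor2) :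
    symmetrization hb t = t ↔ ∀ i j, coordTensor hb i j t = coordTensor hb j i t := by
  constructor
  · intro h i j
    rw [← h, coordTensor_symmetrization, coordTensor_symmetrization, add_comm]
  · intro h
    refine ext_coordTensor hb fun i j => ?_
    rw [coordTensor_symmetrization, ← h i j, half_smul_add_self]

theorem symmetrization_idem (t : C.Tensor2) :
    symmetrization hb (symmetrization hb t) = symmetrization hb t := by
  rw [symmetrization_eq_self_iff]
  intro i j
  rw [coordTensor_symmetrization, coordTensor_symmetrization, add_comm]

theorem coordTensor_sigma (i j : Fin n) (t : C.Tensor2) :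
    coordTensor hb i j (sigma (symmetrization hb) t) = coordTensor hb j i t := by
  have h : sigma (symmetrization hb) t = symmetrization hb t + symmetrization hb t - t := by
    rw [← two_nsmul]; rfl
  rw [h, map_sub, map_add, coordTensor_symmetrization, ← smul_add, half_smul_add_self,
    add_sub_cancel_left]

include hb in
theorem centerMap_bijective : Function.Bijective C.centerMap := by
  have htmul : ∀ (x : C.center) (a : B),
      C.centerMap (x ⊗ₜ[Subalgebra.center ℂ B] a) = op a • (x : C.Form 1) := fun x a => rfl
  let e : Fin n → C.center := fun i => ⟨b i, hb i⟩
  let R : C.Form 1 →+ C.center ⊗[Subalgebra.center ℂ B] B :=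
    { toFun := fun y => ∑ i, e i ⊗ₜ coordForm b i y
      map_zero' := by simp
      map_add' := fun x y => by simp [TensorProduct.tmul_add, Finset.sum_add_distrib] }
  have hR : ∀ y, R y = ∑ i, e i ⊗ₜ[Subalgebra.center ℂ B] coordForm b i y := fun y => rfl
  -- a central one-form is a combination of the `e i` over the center, which moves its coordinates
  -- across the tensor sign
  have hleft : ∀ t, R (C.centerMap t) = t := by
    intro t
    induction t with
    | zero => rw [map_zero, map_zero]
    | add x y hx hy => rw [map_add, map_add, hx, hy]
    | tmul x a =>
      let z : Fin n → Subalgebra.center ℂ B := fun i =>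
        ⟨coordForm b i x, coordForm_mem_center hb x.2 i⟩
      have hx : x = ∑ i, z i • e i := Subtype.ext (by
        rw [AddSubmonoidClass.coe_finsetSum]
        conv_lhs => rw [← sum_coordForm b (x : C.Form 1)]
        exact Finset.sum_congr rfl fun i _ => (hb i _).symm)
      rw [htmul, hR]
      conv_rhs => rw [hx, TensorProduct.sum_tmul]
      refine Finset.sum_congr rfl fun i _ => ?_
      rw [coordForm_right_smul, TensorProduct.smul_tmul]
      rfl
  have hright : ∀ y, C.centerMap (R y) = y := by
    intro y
    rw [hR, map_sum]
    exact sum_coordForm b y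
  exact ⟨Function.LeftInverse.injective hleft, Function.RightInverse.surjective hright⟩

/-- A calculus with a central basis `e` of one-forms for which the `eₚ ∧ e_q`, `p < q`, form a
basis of the two-forms and the `eᵢ` anticommute is tame: the kernel of the wedge map consists of
the symmetric tensors. -/
theorem isTame_symmetrization
    (b₂ : Module.Basis {p : Fin n × Fin n // p.1 < p.2} Bᵐᵒᵖ (C.Form 2))
    (hb₂ : ∀ p, b₂ p = C.wedge (tmul (b p.1.1) (b p.1.2)))
    (hanti : ∀ i j, C.wedge (tmul (b i) (b j)) = -C.wedge (tmul (b j) (b i))) :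
    C.IsTame (symmetrization hb) where
  finite := Module.Finite.of_basis b
  projective := Module.Projective.of_basis b
  wedge_surjective := by
    rw [← LinearMap.range_eq_top, eq_top_iff, ← b₂.span_eq, Submodule.span_le]
    rintro _ ⟨p, rfl⟩
    exact ⟨_, (hb₂ p).symm⟩
  idem := LinearMap.ext (symmetrization_idem hb)
  range_eq := by
    have hself : ∀ i, C.wedge (tmul (b i) (b i)) = 0 := fun i => by
      have h := hanti i i
      have h2 : (2 : ℂ) • C.wedge (tmul (b i) (b i)) = 0 := by
        rw [two_smul]; nth_rewrite 1 [h]; exact neg_add_cancel _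
      exact (smul_eq_zero.1 h2).resolve_left two_ne_zero
    have hw : ∀ t, C.wedge t = ∑ p : {p : Fin n × Fin n // p.1 < p.2},
        op (coordTensor hb p.1.1 p.1.2 t - coordTensor hb p.1.2 p.1.1 t) • b₂ p := by
      intro t
      conv_lhs => rw [← sum_coordTensor hb t]
      simp only [map_sum, map_smul]
      rw [sum_sum_eq_sum_diag_add, Finset.sum_eq_zero fun i _ => by rw [hself, smul_zero],
        zero_add]
      refine Finset.sum_congr rfl fun p _ => ?_
      rw [hanti p.1.2 p.1.1, hb₂, smul_neg, ← sub_eq_add_neg, ← sub_smul, MulOpposite.op_sub]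
    ext t
    have hr : t ∈ LinearMap.range (symmetrization hb) ↔ symmetrization hb t = t :=
      ⟨by rintro ⟨s, rfl⟩; exact symmetrization_idem hb s, fun h => ⟨t, h⟩⟩
    rw [hr, symmetrization_eq_self_iff, LinearMap.mem_ker, hw]
    constructor
    · intro h
      exact Finset.sum_eq_zero fun p _ => by rw [h p.1.1 p.1.2]; simp
    · intro h
      have h0 : ∀ i j, i < j → coordTensor hb i j t = coordTensor hb j i t := fun i j hij => by
        have := Fintype.linearIndependent_iff.1 b₂.linearIndependent _ h ⟨(i, j), hij⟩
        exact sub_eq_zero.1 (MulOpposite.op_injective this)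
      intro i j
      rcases lt_trichotomy i j with h1 | h1 | h1
      · exact h0 i j h1
      · rw [h1]
      · exact (h0 j i h1).symm
  left_linear a t := ext_coordTensor hb fun i j => by
    simp only [coordTensor_symmetrization, coordTensor_left_smul, ← mul_add, mul_smul_comm]
  centered := centerMap_bijective hb
  sigma_flip x hx y hy := ext_coordTensor hb fun i j => by
    rw [coordTensor_sigma, coordTensor_tmul, coordTensor_tmul]
    exact Subalgebra.mem_center_iff.1 (coordForm_mem_center hb hy i) _

/-- The metric `g (eᵢ ⊗ eⱼ a) = δᵢⱼ a`. -/
noncomputable def canonicalMetric : C.Tensor2 →ₗ[Bᵐᵒᵖ] B where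
  toFun t := ∑ i, coordTensor hb i i t
  map_add' s t := by simp [Finset.sum_add_distrib]
  map_smul' a t := by simp [coordTensor_right_smul, Finset.sum_mul]

theorem canonicalMetric_apply (t : C.Tensor2) :
    canonicalMetric hb t = ∑ i, coordTensor hb i i t := rfl

theorem canonicalMetric_basis (i j : Fin n) :
    canonicalMetric hb (tmul (b i) (b j)) = if i = j then 1 else 0 := by
  simp only [canonicalMetric_apply, coordTensor_tmul, coordForm_basis]
  simp [eq_comm]

theorem isBilinearMetric_canonicalMetric :
    C.IsBilinearMetric (symmetrization hb) (canonicalMetric hb) where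
  symmetric := LinearMap.ext fun t => by
    simp only [LinearMap.comp_apply, canonicalMetric_apply, coordTensor_sigma]
  nondegenerate := by
    have happ : ∀ x y, metricDual (canonicalMetric hb) x y =
        ∑ i, coordForm b i x * coordForm b i y := fun x y => rfl
    have hbas : ∀ x j, metricDual (canonicalMetric hb) x (b j) = coordForm b j x := fun x j => by
      rw [happ]
      simp [coordForm_basis]
    refine ⟨fun x y h => ext_coordForm b fun i => ?_, fun f => ?_⟩
    · rw [← hbas, ← hbas, h]
    · refine ⟨∑ j, op (f (b j)) • b j, b.ext fun i => ?_⟩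
      rw [hbas, coordForm_sum]
  left_linear a t := by
    simp only [canonicalMetric_apply, coordTensor_left_smul, Finset.mul_sum]

end DifferentialCalculus

namespace DiracTriple

open MulOpposite (op unop)
open DifferentialCalculus (tmul)

variable {B : Type*} [Ring B] [StarRing B] [Algebra ℂ B] {H : Type*}
    [NormedAddCommGroup H] [InnerProductSpace ℂ H] [CompleteSpace H] {T : DiracTriple B H}

/-! ### Classes of operators in Connes' calculus -/

section FormClass

variable {k l : ℕ} {X Y : H →L[ℂ] H}

theorem formClass_congr (h : X = Y) (hX : X ∈ T.opForms k) (hY : Y ∈ T.opForms k) :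
    formClass hX = formClass hY := by
  subst h; rfl

theorem val_formClass_rep {ω : UniversalForms B} (hω : ω ∈ UniversalForms.grade B k)
    (h : T.rep ω ∈ T.opForms k) :
    T.connesCalculus.val k (formClass h) = T.totalProj k ⟨ω, hω⟩ := rfl

theorem formClass_add (hX : X ∈ T.opForms k) (hY : Y ∈ T.opForms k) :
    formClass (add_mem hX hY) = formClass hX + formClass hY :=
  DifferentialCalculus.form_ext <| by
    change DirectSum.lof ℂ ℕ T.ConnesForm k (T.cls k (⟨X, hX⟩ + ⟨Y, hY⟩)) = _
    rw [map_add, map_add]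
    rfl

theorem formClass_eq_zero_iff (hX : X ∈ T.opForms k) : formClass hX = 0 ↔ X ∈ T.junk k := by
  refine Iff.trans ?_ (T.cls_eq_zero ⟨X, hX⟩)
  constructor
  · intro h
    have h1 : DirectSum.of T.ConnesForm k (T.cls k ⟨X, hX⟩) = 0 :=
      congrArg (T.connesCalculus.val k) h
    exact DirectSum.of_injective (β := T.ConnesForm) k (h1.trans (map_zero _).symm)
  · intro h
    refine DifferentialCalculus.form_ext ?_
    change DirectSum.lof ℂ ℕ T.ConnesForm k (T.cls k ⟨X, hX⟩) = 0
    rw [h, map_zero]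

theorem formClass_sum {κ : Type*} (s : Finset κ) {X : κ → H →L[ℂ] H}
    (hX : ∀ i, X i ∈ T.opForms k) (h : ∑ i ∈ s, X i ∈ T.opForms k) :
    formClass h = ∑ i ∈ s, formClass (hX i) := by
  classical
  induction s using Finset.induction_on with
  | empty =>
    refine ((formClass_eq_zero_iff h).2 ?_).trans Finset.sum_empty.symm
    rw [Finset.sum_empty]
    exact zero_mem _
  | insert i s hi ih =>
    have hs : ∑ i ∈ s, X i ∈ T.opForms k := sum_mem fun i _ => hX i
    refine (formClass_congr (Finset.sum_insert hi) h (add_mem (hX i) hs)).trans ?_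
    rw [formClass_add (hX i) hs, ih hs, Finset.sum_insert hi]

theorem exists_formClass (x : T.connesCalculus.Form k) :
    ∃ (X : H →L[ℂ] H) (hX : X ∈ T.opForms k), formClass hX = x := by
  obtain ⟨x, ⟨y, rfl⟩⟩ := x
  obtain ⟨⟨X, hX⟩, rfl⟩ := T.cls_surjective k y
  exact ⟨X, hX, rfl⟩

theorem π_mem_opForms (a : B) : T.π a ∈ T.opForms 0 :=
  ⟨_, UniversalForms.incl_mem_grade a, by simp [rep]⟩

omit [StarRing B] in
theorem incl_mul_symb_mem_grade (a b : B) :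
    UniversalForms.incl B a * UniversalForms.symb B b ∈ UniversalForms.grade B 1 := by
  simpa using UniversalForms.mul_mem_grade (UniversalForms.incl_mem_grade a)
    (UniversalForms.symb_mem_grade b)

theorem rep_delta_incl_mul_symb (a b : B) :
    T.rep (UniversalForms.delta B (UniversalForms.incl B a * UniversalForms.symb B b)) =
      T.rep (UniversalForms.symb B a) * T.rep (UniversalForms.symb B b) := by
  rw [UniversalForms.leibniz (UniversalForms.incl_mem_grade a) (UniversalForms.symb_mem_grade b)]
  simp

theorem rep_incl (a : B) : T.rep (UniversalForms.incl B a) = T.π a := by simp [rep]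

theorem rep_symb (a : B) : T.rep (UniversalForms.symb B a) = T.comm a := by simp [rep, commL]

theorem exists_rep_of_mem_opForms (hX : X ∈ T.opForms k) :
    ∃ ω ∈ UniversalForms.grade B k, T.rep ω = X := hX

theorem right_smul_formClass (a : B) (hX : X ∈ T.opForms k) (h : X * T.π a ∈ T.opForms k) :
    op a • formClass hX = formClass h := by
  obtain ⟨ω, hω, rfl⟩ := exists_rep_of_mem_opForms hX
  have hm : ω * UniversalForms.incl B a ∈ UniversalForms.grade B k := by
    simpa using UniversalForms.mul_mem_grade hω (UniversalForms.incl_mem_grade a)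
  have he : T.rep ω * T.π a = T.rep (ω * UniversalForms.incl B a) := by rw [map_mul, rep_incl]
  rw [formClass_congr he h (T.rep_mem hm)]
  refine DifferentialCalculus.form_ext ?_
  rw [DifferentialCalculus.coe_right_smul, val_formClass_rep hω, val_formClass_rep hm]
  exact T.totalProj_mul ⟨ω, hω⟩ ⟨_, UniversalForms.incl_mem_grade a⟩

theorem left_smul_formClass (a : B) (hX : X ∈ T.opForms k) (h : T.π a * X ∈ T.opForms k) :
    a • formClass hX = formClass h := by
  obtain ⟨ω, hω, rfl⟩ := exists_rep_of_mem_opForms hX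
  have hm : UniversalForms.incl B a * ω ∈ UniversalForms.grade B k := by
    simpa using UniversalForms.mul_mem_grade (UniversalForms.incl_mem_grade a) hω
  have he : T.π a * T.rep ω = T.rep (UniversalForms.incl B a * ω) := by rw [map_mul, rep_incl]
  rw [formClass_congr he h (T.rep_mem hm)]
  refine DifferentialCalculus.form_ext ?_
  rw [DifferentialCalculus.coe_left_smul, val_formClass_rep hω, val_formClass_rep hm]
  exact (T.totalProj_mul ⟨_, UniversalForms.incl_mem_grade a⟩ ⟨ω, hω⟩).trans
    (T.totalProj_congr (zero_add k) _ ⟨_, hm⟩ rfl)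

theorem wedge_formClass (hX : X ∈ T.opForms 1) (hY : Y ∈ T.opForms 1)
    (h : X * Y ∈ T.opForms 2) :
    T.connesCalculus.wedge (tmul (formClass hX) (formClass hY)) = formClass h := by
  obtain ⟨ω, hω, rfl⟩ := exists_rep_of_mem_opForms hX
  obtain ⟨η, hη, rfl⟩ := exists_rep_of_mem_opForms hY
  have hm : ω * η ∈ UniversalForms.grade B 2 :=
    UniversalForms.mul_mem_grade (k := 1) (l := 1) hω hη
  rw [formClass_congr (map_mul T.rep ω η).symm h (T.rep_mem hm)]
  refine DifferentialCalculus.form_ext ?_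
  rw [DifferentialCalculus.wedge_tmul, val_formClass_rep hω, val_formClass_rep hη,
    val_formClass_rep hm]
  exact T.totalProj_mul ⟨ω, hω⟩ ⟨η, hη⟩

theorem d_formClass_rep {ω : UniversalForms B} (hω : ω ∈ UniversalForms.grade B k) :
    T.connesCalculus.d (T.connesCalculus.val k (formClass (T.rep_mem hω))) =
      T.connesCalculus.val (k + 1)
        (formClass (T.rep_mem (UniversalForms.delta_grade hω).1)) :=
  T.dTotal_totalProj ⟨ω, hω⟩

/-- There is no junk in degree one, because the representation is faithful. -/
theorem junk_one : T.junk 1 = ⊥ := by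
  rw [eq_bot_iff]
  rintro _ ⟨_, ⟨ω, ⟨hω, hω'⟩, rfl⟩, rfl⟩
  rw [SetLike.mem_coe, UniversalForms.grade, pow_zero, mul_one] at hω
  obtain ⟨a, rfl⟩ := hω
  have h : T.π a = 0 := (rep_incl (T := T) a).symm.trans hω'
  have ha : a = 0 := T.faithful (h.trans (map_zero _).symm)
  rw [ha]
  simp

end FormClass

/-! ### Dirac triples of Clifford type -/

variable {n : ℕ}

/-- A Dirac triple with `[D, π a] = ∑ᵢ π (∂ᵢ a) Γᵢ` for commuting derivations `∂ᵢ` and operators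
`Γᵢ` in the commutant of `π` that satisfy the Clifford relations, together with elements `uᵢ` with
left inverses `vᵢ` that separate the derivations. -/
structure IsCliffordType (T : DiracTriple B H) (der : Fin n → (B →ₗ[ℂ] B))
    (Γ : Fin n → (H →L[ℂ] H)) (u v : Fin n → B) : Prop where
  commute : ∀ i a, Γ i * T.π a = T.π a * Γ i
  sq : ∀ i, Γ i * Γ i = 1
  anticomm : ∀ i j, i ≠ j → Γ i * Γ j = -(Γ j * Γ i)
  comm_eq : ∀ a, T.comm a = ∑ i, T.π (der i a) * Γ i
  der_mul : ∀ i a b, der i (a * b) = der i a * b + a * der i b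
  der_comm : ∀ i j a, der i (der j a) = der j (der i a)
  left_inv : ∀ i, v i * u i = 1
  der_u : ∀ i j, der i (u j) = if i = j then u j else 0
  der_v : ∀ i j, der i (v j) = if i = j then -v j else 0

/-- The operator `∑ᵢ π (aᵢ) Γᵢ`. -/
noncomputable def clifford₁ (T : DiracTriple B H) (Γ : Fin n → (H →L[ℂ] H)) (a : Fin n → B) : H →L[ℂ] H :=
  ∑ i, T.π (a i) * Γ i

/-- The operator `∑ᵢⱼ π (cᵢⱼ) Γᵢ Γⱼ`. -/
noncomputable def clifford₂ (T : DiracTriple B H) (Γ : Fin n → (H →L[ℂ] H)) (c : Fin n → Fin n → B) :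
    H →L[ℂ] H :=
  ∑ i, ∑ j, T.π (c i j) * (Γ i * Γ j)

variable (Γ : Fin n → (H →L[ℂ] H))

theorem clifford₁_add (a b : Fin n → B) :
    T.clifford₁ Γ (a + b) = T.clifford₁ Γ a + T.clifford₁ Γ b := by
  simp [clifford₁, add_mul, Finset.sum_add_distrib]

theorem clifford₁_sub (a b : Fin n → B) :
    T.clifford₁ Γ (a - b) = T.clifford₁ Γ a - T.clifford₁ Γ b := by
  simp [clifford₁, sub_mul, Finset.sum_sub_distrib]

theorem clifford₂_add (a b : Fin n → Fin n → B) :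
    T.clifford₂ Γ (a + b) = T.clifford₂ Γ a + T.clifford₂ Γ b := by
  simp [clifford₂, add_mul, Finset.sum_add_distrib]

theorem clifford₂_sub (a b : Fin n → Fin n → B) :
    T.clifford₂ Γ (a - b) = T.clifford₂ Γ a - T.clifford₂ Γ b := by
  simp [clifford₂, sub_mul, Finset.sum_sub_distrib]

theorem π_mul_clifford₁ (b : B) (a : Fin n → B) :
    T.π b * T.clifford₁ Γ a = T.clifford₁ Γ fun i => b * a i := by
  simp only [clifford₁, Finset.mul_sum, map_mul, mul_assoc]

variable {Γ} {der : Fin n → (B →ₗ[ℂ] B)} {u v : Fin n → B} (hT : T.IsCliffordType der Γ u v)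

namespace IsCliffordType

include hT

theorem comm_eq_clifford₁ (a : B) : T.comm a = T.clifford₁ Γ fun i => der i a := hT.comm_eq a

theorem der_one (i : Fin n) : der i 1 = 0 := by
  simpa using hT.der_mul i 1 1

theorem clifford₁_mul_clifford₁ (a b : Fin n → B) :
    T.clifford₁ Γ a * T.clifford₁ Γ b = T.clifford₂ Γ fun i j => a i * b j := by
  simp only [clifford₁, clifford₂, Finset.sum_mul_sum]
  refine Finset.sum_congr rfl fun i _ => Finset.sum_congr rfl fun j _ => ?_
  rw [map_mul, mul_assoc, ← mul_assoc (Γ i), hT.commute i]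
  simp only [mul_assoc]

theorem clifford_relation (i j : Fin n) : Γ i * Γ j + Γ j * Γ i = if i = j then 2 else 0 := by
  split_ifs with h
  · rw [h, hT.sq, one_add_one_eq_two]
  · rw [hT.anticomm i j h, neg_add_cancel]

/-- The coefficients of `∑ᵢ π (aᵢ) Γᵢ` are determined by the operator: its anticommutator with
`Γᵣ` is `2 π (aᵣ)`. -/
theorem clifford₁_eq_zero {a : Fin n → B} (h : T.clifford₁ Γ a = 0) : a = 0 := by
  funext r
  have h1 : T.clifford₁ Γ a * Γ r + Γ r * T.clifford₁ Γ a = (2 : ℂ) • T.π (a r) := by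
    simp only [clifford₁, Finset.sum_mul, Finset.mul_sum, ← Finset.sum_add_distrib]
    have h2 : ∀ i, T.π (a i) * Γ i * Γ r + Γ r * (T.π (a i) * Γ i) =
        if i = r then (2 : ℂ) • T.π (a i) else 0 := fun i => by
      rw [← mul_assoc (Γ r), hT.commute r, mul_assoc, mul_assoc, ← mul_add,
        hT.clifford_relation i r]
      split_ifs
      · rw [two_smul, mul_two]
      · rw [mul_zero]
    simp [h2]
  rw [h, zero_mul, mul_zero, add_zero] at h1
  have h3 := (smul_eq_zero.1 h1.symm).resolve_left two_ne_zero
  exact T.faithful (h3.trans (map_zero _).symm)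

theorem clifford₁_injective : Function.Injective (T.clifford₁ Γ) := fun a b h =>
  sub_eq_zero.1 (hT.clifford₁_eq_zero (by rw [clifford₁_sub, h, sub_self]))

/-- A relation `∑ᵢⱼ π (cᵢⱼ) Γᵢ Γⱼ = 0` forces `c` to be symmetric: the commutator of the left-hand
side with `Γᵣ` is `2 ∑ᵢ π (cᵢᵣ - cᵣᵢ) Γᵢ`. -/
theorem clifford₂_eq_zero {c : Fin n → Fin n → B} (h : T.clifford₂ Γ c = 0) (i r : Fin n) :
    c i r = c r i := by
  have h1 : T.clifford₂ Γ c * Γ r - Γ r * T.clifford₂ Γ c =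
      (2 : ℂ) • T.clifford₁ Γ fun i => c i r - c r i := by
    have h2 : ∀ i j, T.π (c i j) * (Γ i * Γ j) * Γ r - Γ r * (T.π (c i j) * (Γ i * Γ j)) =
        (if j = r then (2 : ℂ) • (T.π (c i j) * Γ i) else 0) -
          if i = r then (2 : ℂ) • (T.π (c i j) * Γ j) else 0 := fun i j => by
      rw [← mul_assoc (Γ r), hT.commute r, mul_assoc, mul_assoc (T.π _) (Γ r), ← mul_sub]
      have h3 : Γ i * Γ j * Γ r - Γ r * (Γ i * Γ j) =
          Γ i * (Γ j * Γ r + Γ r * Γ j) - (Γ i * Γ r + Γ r * Γ i) * Γ j := by noncomm_ring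
      rw [h3, hT.clifford_relation, hT.clifford_relation, mul_sub]
      congr 1
      · split_ifs
        · rw [mul_two, two_smul, mul_add]
        · rw [mul_zero, mul_zero]
      · split_ifs
        · rw [two_mul, two_smul, mul_add]
        · rw [zero_mul, mul_zero]
    simp only [clifford₂, clifford₁, Finset.sum_mul, Finset.mul_sum, ← Finset.sum_sub_distrib, h2]
    simp only [Finset.sum_sub_distrib, map_sub, sub_mul, smul_sub, Finset.smul_sum]
    congr 1
    · simp
    · rw [Finset.sum_comm]; simp
  rw [h, zero_mul, mul_zero, sub_zero] at h1
  have h4 := hT.clifford₁_eq_zero ((smul_eq_zero.1 h1.symm).resolve_left two_ne_zero)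
  exact sub_eq_zero.1 (congrFun h4 i)

/-! ### One-forms and two-forms of a triple of Clifford type -/

theorem generator_mem (i : Fin n) : Γ i ∈ T.opForms 1 := by
  have hm := incl_mul_symb_mem_grade (v i) (u i)
  have h : T.rep (UniversalForms.incl B (v i) * UniversalForms.symb B (u i)) = Γ i := by
    rw [map_mul, rep_incl, rep_symb, hT.comm_eq]
    simp only [hT.der_u]
    rw [Finset.sum_eq_single i (fun j _ hj => by simp [hj]) (by simp), if_pos rfl, ← mul_assoc,
      ← map_mul, hT.left_inv, map_one, one_mul]
  exact h ▸ T.rep_mem hm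

theorem π_mul_generator_mem (a : B) (i : Fin n) : T.π a * Γ i ∈ T.opForms 1 := by
  simpa using T.opForms_mul (π_mem_opForms a) (hT.generator_mem i)

theorem clifford₁_mem (a : Fin n → B) : T.clifford₁ Γ a ∈ T.opForms 1 :=
  sum_mem fun i _ => hT.π_mul_generator_mem (a i) i

theorem π_mul_generators_mem (a : B) (i j : Fin n) : T.π a * (Γ i * Γ j) ∈ T.opForms 2 := by
  rw [← mul_assoc]
  exact T.opForms_mul (k := 1) (l := 1) (hT.π_mul_generator_mem a i) (hT.generator_mem j)

theorem clifford₂_mem (c : Fin n → Fin n → B) : T.clifford₂ Γ c ∈ T.opForms 2 :=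
  sum_mem fun i _ => sum_mem fun j _ => hT.π_mul_generators_mem (c i j) i j

/-- A universal one-form `ω` is represented by some `∑ᵢ π (aᵢ) Γᵢ`, and `δ ω` by some
`∑ᵢⱼ π (cᵢⱼ) Γᵢ Γⱼ` whose antisymmetric part is determined by `a`. This is where the derivations
are required to commute. -/
theorem exists_rep_delta {ω : UniversalForms B} (hω : ω ∈ UniversalForms.grade B 1) :
    ∃ (a : Fin n → B) (c : Fin n → Fin n → B), T.rep ω = T.clifford₁ Γ a ∧
      T.rep (UniversalForms.delta B ω) = T.clifford₂ Γ c ∧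
      ∀ p q, c p q - c q p = der p (a q) - der q (a p) := by
  rw [UniversalForms.grade, pow_one] at hω
  refine Submodule.mul_induction_on hω ?_ ?_
  · rintro _ ⟨a, rfl⟩ _ ⟨b, rfl⟩
    refine ⟨fun i => a * der i b, fun i j => der i a * der j b, ?_, ?_, fun p q => ?_⟩
    · change T.rep (UniversalForms.incl B a * UniversalForms.symb B b) = _
      rw [map_mul, rep_incl, rep_symb, hT.comm_eq_clifford₁, π_mul_clifford₁]
    · change T.rep (UniversalForms.delta B
        (UniversalForms.incl B a * UniversalForms.symb B b)) = _
      rw [rep_delta_incl_mul_symb, rep_symb, rep_symb, hT.comm_eq_clifford₁,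
        hT.comm_eq_clifford₁, hT.clifford₁_mul_clifford₁]
    · rw [hT.der_mul, hT.der_mul, hT.der_comm q p]
      abel
  · rintro x y ⟨a, c, h1, h2, h3⟩ ⟨a', c', h1', h2', h3'⟩
    refine ⟨a + a', c + c', ?_, ?_, fun p q => ?_⟩
    · rw [map_add, h1, h1', clifford₁_add]
    · rw [map_add, map_add, h2, h2', clifford₂_add]
    · have e1 := h3 p q
      have e2 := h3' p q
      simp only [Pi.add_apply, map_add]
      rw [add_sub_add_comm, e1, e2]
      abel

theorem exists_clifford₁ {X : H →L[ℂ] H} (hX : X ∈ T.opForms 1) :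
    ∃ a, X = T.clifford₁ Γ a := by
  obtain ⟨ω, hω, rfl⟩ := hX
  obtain ⟨a, _, h, _⟩ := hT.exists_rep_delta hω
  exact ⟨a, h⟩

theorem exists_clifford₂ {X : H →L[ℂ] H} (hX : X ∈ T.opForms 2) :
    ∃ c, X = T.clifford₂ Γ c := by
  obtain ⟨ω, hω, rfl⟩ := hX
  rw [SetLike.mem_coe, UniversalForms.grade, pow_succ, ← mul_assoc] at hω
  refine Submodule.mul_induction_on hω ?_ ?_
  · rintro x hx _ ⟨b, rfl⟩
    obtain ⟨a, h⟩ := hT.exists_clifford₁ (T.rep_mem hx)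
    refine ⟨fun i j => a i * der j b, ?_⟩
    change T.rep _ = _
    rw [map_mul, h, rep_symb, hT.comm_eq_clifford₁, hT.clifford₁_mul_clifford₁]
  · rintro x y ⟨c, h⟩ ⟨c', h'⟩
    exact ⟨c + c', by rw [clifford₂_add, ← h, ← h']; exact map_add T.rep x y⟩

/-- The unit is a junk form as soon as there is a derivation: `v² δ(u²) - 2 v δ u` is represented
by `0`, and its differential by `-2`. -/
theorem one_mem_junk (i : Fin n) : (1 : H →L[ℂ] H) ∈ T.junk 2 := by
  have hcomm : ∀ x : B, (∀ j, j ≠ i → der j x = 0) → T.comm x = T.π (der i x) * Γ i := by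
    intro x hx
    rw [hT.comm_eq]
    exact Finset.sum_eq_single i (fun j _ hj => by rw [hx j hj, map_zero, zero_mul]) (by simp)
  have hu : T.comm (u i) = T.π (u i) * Γ i := by
    rw [hcomm _ fun j hj => by rw [hT.der_u, if_neg hj], hT.der_u, if_pos rfl]
  have hv : T.comm (v i) = -(T.π (v i) * Γ i) := by
    rw [hcomm _ fun j hj => by rw [hT.der_v, if_neg hj], hT.der_v, if_pos rfl, map_neg, neg_mul]
  have hmul : ∀ x y, T.comm (x * y) = T.comm x * T.π y + T.π x * T.comm y := T.commL_mul
  have hvu : T.π (v i) * T.π (u i) = 1 := by rw [← map_mul, hT.left_inv, map_one]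
  have huu : T.comm (u i * u i) = (2 : ℂ) • (T.π (u i) * T.π (u i) * Γ i) := by
    rw [hmul, hu, mul_assoc, hT.commute, ← mul_assoc, two_smul]
  have hvv : T.comm (v i * v i) = -((2 : ℂ) • (T.π (v i) * T.π (v i) * Γ i)) := by
    rw [hmul, hv, neg_mul, mul_neg, mul_assoc, hT.commute, ← mul_assoc, two_smul,
      neg_add]
  have hvvuu : T.π (v i) * T.π (v i) * (T.π (u i) * T.π (u i)) = 1 := by
    rw [mul_assoc, ← mul_assoc (T.π (v i)) (T.π (u i)), hvu, one_mul, hvu]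
  have hdelta : ∀ x y : B, T.rep (UniversalForms.delta B
      (UniversalForms.incl B x * UniversalForms.symb B y)) = T.comm x * T.comm y := fun x y => by
    rw [rep_delta_incl_mul_symb, rep_symb, rep_symb]
  have hrep : ∀ x y : B, T.rep (UniversalForms.incl B x * UniversalForms.symb B y) =
      T.π x * T.comm y := fun x y => by rw [map_mul, rep_incl, rep_symb]
  refine ⟨_, ⟨(-1 / 2 : ℂ) • (UniversalForms.incl B (v i * v i) * UniversalForms.symb B (u i * u i)
    - (2 : ℂ) • (UniversalForms.incl B (v i) * UniversalForms.symb B (u i))), ⟨?_, ?_⟩, rfl⟩, ?_⟩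
  · exact Submodule.smul_mem _ _ (sub_mem (incl_mul_symb_mem_grade _ _) (Submodule.smul_mem _ _ (incl_mul_symb_mem_grade _ _)))
  · change T.rep _ = 0
    rw [map_smul, map_sub, map_smul, hrep, hrep, huu, hu, map_mul, mul_smul_comm,
      ← mul_assoc (T.π (v i) * T.π (v i)) _ (Γ i), hvvuu, ← mul_assoc (T.π (v i)), hvu, sub_self,
      smul_zero]
  · change T.rep _ = 1
    have h1 : T.π (v i) * Γ i * (T.π (u i) * Γ i) = 1 := by
      rw [mul_assoc, ← mul_assoc (Γ i), hT.commute, mul_assoc, hT.sq, mul_one, hvu]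
    have h2 : T.π (v i) * T.π (v i) * Γ i * (T.π (u i) * T.π (u i) * Γ i) = 1 := by
      rw [mul_assoc, ← mul_assoc (Γ i), ← map_mul, ← map_mul, hT.commute, mul_assoc, hT.sq,
        mul_one, map_mul, map_mul, hvvuu]
    rw [map_smul, map_sub, map_smul, map_smul, map_sub, map_smul, hdelta, hdelta, huu, hvv, hu, hv,
      neg_mul, neg_mul, smul_mul_smul_comm, h1, h2, smul_neg, sub_neg_eq_add, smul_add, smul_neg,
      smul_smul, smul_smul]
    rw [← neg_smul, ← add_smul]
    norm_num

theorem π_mem_junk (i : Fin n) (a : B) : T.π a ∈ T.junk 2 := by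
  have h := T.junk_mul (hT.one_mem_junk i) (π_mem_opForms a)
  rwa [one_mul] at h

/-- The junk two-forms are the `∑ᵢⱼ π (cᵢⱼ) Γᵢ Γⱼ` with `c` symmetric. -/
theorem clifford₂_mem_junk_iff (c : Fin n → Fin n → B) :
    T.clifford₂ Γ c ∈ T.junk 2 ↔ ∀ i j, c i j = c j i := by
  constructor
  · rintro ⟨_, ⟨ω, ⟨hω, hω'⟩, rfl⟩, h⟩ i j
    obtain ⟨a, c', h1, h2, h3⟩ := hT.exists_rep_delta hω
    have ha : a = 0 := hT.clifford₁_eq_zero (h1.symm.trans hω')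
    have h4 : T.clifford₂ Γ (c - c') = 0 := by
      rw [clifford₂_sub, sub_eq_zero, ← h2]; exact h.symm
    have h5 := hT.clifford₂_eq_zero h4 i j
    have h6 := h3 i j
    simp only [ha, Pi.zero_apply, map_zero, sub_zero] at h6
    simp only [Pi.sub_apply, sub_eq_zero.1 h6] at h5
    exact sub_left_injective h5
  · intro h
    rw [clifford₂, sum_sum_eq_sum_diag_add]
    refine add_mem (sum_mem fun i _ => ?_) (sum_mem fun p _ => ?_)
    · rw [hT.sq, mul_one]
      exact hT.π_mem_junk i _
    · rw [h p.1.2 p.1.1, hT.anticomm _ _ p.2.ne, mul_neg, neg_add_cancel]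
      exact zero_mem _

/-- The one-form `eᵢ`, the class of `Γᵢ`. -/
noncomputable def oneForm (i : Fin n) : T.connesCalculus.Form 1 := formClass (hT.generator_mem i)

theorem sum_op_smul_oneForm (a : Fin n → B) :
    ∑ i, op (a i) • hT.oneForm i = formClass (hT.clifford₁_mem a) := by
  refine Eq.trans ?_ (formClass_sum Finset.univ (fun i => hT.π_mul_generator_mem (a i) i) _).symm
  refine Finset.sum_congr rfl fun i _ => ?_
  have h : Γ i * T.π (a i) ∈ T.opForms 1 := by
    rw [hT.commute]; exact hT.π_mul_generator_mem _ _
  exact (right_smul_formClass (a i) (hT.generator_mem i) h).trans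
    (formClass_congr (hT.commute i (a i)) _ _)

theorem oneForm_mem_center (i : Fin n) : hT.oneForm i ∈ T.connesCalculus.center := by
  intro a
  have h : Γ i * T.π a ∈ T.opForms 1 := by
    rw [hT.commute]; exact hT.π_mul_generator_mem _ _
  exact (left_smul_formClass a (hT.generator_mem i) (hT.π_mul_generator_mem a i)).trans
    ((formClass_congr (hT.commute i a).symm _ _).trans
      (right_smul_formClass a (hT.generator_mem i) h).symm)

theorem linearIndependent_oneForm : LinearIndependent Bᵐᵒᵖ hT.oneForm := by
  refine Fintype.linearIndependent_iff.2 fun g hg i => ?_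
  have h : formClass (hT.clifford₁_mem fun i => (g i).unop) = 0 :=
    (hT.sum_op_smul_oneForm fun i => (g i).unop).symm.trans hg
  rw [formClass_eq_zero_iff, junk_one, Submodule.mem_bot] at h
  exact MulOpposite.unop_injective (congrFun (hT.clifford₁_eq_zero h) i)

theorem exists_sum_op_smul_oneForm (x : T.connesCalculus.Form 1) :
    ∃ a : Fin n → B, ∑ i, op (a i) • hT.oneForm i = x := by
  obtain ⟨X, hX, rfl⟩ := exists_formClass x
  obtain ⟨a, rfl⟩ := hT.exists_clifford₁ hX
  exact ⟨a, hT.sum_op_smul_oneForm a⟩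

/-- The basis `e₁, …, eₙ` of the right module of one-forms. -/
noncomputable def oneFormBasis : Module.Basis (Fin n) Bᵐᵒᵖ (T.connesCalculus.Form 1) :=
  Module.Basis.mk hT.linearIndependent_oneForm (by
    rintro x -
    obtain ⟨a, rfl⟩ := hT.exists_sum_op_smul_oneForm x
    exact sum_mem fun i _ => Submodule.smul_mem _ _ (Submodule.subset_span ⟨i, rfl⟩))

theorem oneFormBasis_apply (i : Fin n) : hT.oneFormBasis i = hT.oneForm i :=
  Module.Basis.mk_apply _ _ i

theorem generators_mem (i j : Fin n) : Γ i * Γ j ∈ T.opForms 2 :=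
  T.opForms_mul (k := 1) (l := 1) (hT.generator_mem i) (hT.generator_mem j)

/-- The two-form `eᵢ ∧ eⱼ`. -/
noncomputable def twoForm (i j : Fin n) : T.connesCalculus.Form 2 :=
  T.connesCalculus.wedge (tmul (hT.oneForm i) (hT.oneForm j))

theorem twoForm_eq (i j : Fin n) : hT.twoForm i j = formClass (hT.generators_mem i j) :=
  wedge_formClass _ _ _

theorem twoForm_self (i : Fin n) : hT.twoForm i i = 0 := by
  rw [twoForm_eq, formClass_eq_zero_iff, hT.sq]
  exact hT.one_mem_junk i

theorem twoForm_anticomm (i j : Fin n) : hT.twoForm i j = -hT.twoForm j i := by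
  rcases eq_or_ne i j with rfl | h
  · rw [twoForm_self, neg_zero]
  · rw [eq_neg_iff_add_eq_zero, twoForm_eq, twoForm_eq, ← formClass_add, formClass_eq_zero_iff,
      hT.anticomm i j h, neg_add_cancel]
    exact zero_mem _

theorem sum_op_smul_twoForm (c : Fin n → Fin n → B) :
    ∑ i, ∑ j, op (c i j) • hT.twoForm i j = formClass (hT.clifford₂_mem c) := by
  have h1 : ∀ i, ∑ j, T.π (c i j) * (Γ i * Γ j) ∈ T.opForms 2 := fun i =>
    sum_mem fun j _ => hT.π_mul_generators_mem (c i j) i j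
  refine Eq.trans ?_ (formClass_sum Finset.univ h1 _).symm
  refine Finset.sum_congr rfl fun i _ => ?_
  refine Eq.trans ?_
    (formClass_sum Finset.univ (fun j => hT.π_mul_generators_mem (c i j) i j) _).symm
  refine Finset.sum_congr rfl fun j _ => ?_
  have he : Γ i * Γ j * T.π (c i j) = T.π (c i j) * (Γ i * Γ j) := by
    rw [mul_assoc, hT.commute, ← mul_assoc, hT.commute, mul_assoc]
  have h : Γ i * Γ j * T.π (c i j) ∈ T.opForms 2 := by
    rw [he]; exact hT.π_mul_generators_mem _ _ _
  rw [twoForm_eq, right_smul_formClass (c i j) (hT.generators_mem i j) h]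
  exact formClass_congr he _ _

/-- The class of `∑ᵢⱼ π (cᵢⱼ) Γᵢ Γⱼ` depends only on the antisymmetric part of `c`. -/
theorem formClass_clifford₂ (c : Fin n → Fin n → B) :
    formClass (hT.clifford₂_mem c) = ∑ p : {p : Fin n × Fin n // p.1 < p.2},
      op (c p.1.1 p.1.2 - c p.1.2 p.1.1) • hT.twoForm p.1.1 p.1.2 := by
  rw [← hT.sum_op_smul_twoForm, sum_sum_eq_sum_diag_add,
    Finset.sum_eq_zero fun i _ => by rw [hT.twoForm_self, smul_zero], zero_add]
  refine Finset.sum_congr rfl fun p _ => ?_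
  rw [hT.twoForm_anticomm p.1.2 p.1.1, smul_neg, ← sub_eq_add_neg, ← sub_smul, MulOpposite.op_sub]

theorem linearIndependent_twoForm : LinearIndependent Bᵐᵒᵖ
    fun p : {p : Fin n × Fin n // p.1 < p.2} => hT.twoForm p.1.1 p.1.2 := by
  refine Fintype.linearIndependent_iff.2 fun g hg p => ?_
  let c : Fin n → Fin n → B := fun i j => if h : i < j then (g ⟨(i, j), h⟩).unop else 0
  have hc : ∀ q : {p : Fin n × Fin n // p.1 < p.2},
      c q.1.1 q.1.2 - c q.1.2 q.1.1 = (g q).unop := fun q => by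
    simp only [c, dif_pos q.2, dif_neg q.2.not_gt, sub_zero]
  have h : formClass (hT.clifford₂_mem c) = 0 := by
    rw [formClass_clifford₂ hT]
    simp only [hc, MulOpposite.op_unop]
    exact hg
  rw [formClass_eq_zero_iff, clifford₂_mem_junk_iff hT] at h
  have h1 := hc p
  rw [h p.1.1 p.1.2, sub_self] at h1
  exact MulOpposite.unop_injective h1.symm

/-- The basis `eₚ ∧ e_q`, `p < q`, of the right module of two-forms. -/
noncomputable def twoFormBasis : Module.Basis {p : Fin n × Fin n // p.1 < p.2} Bᵐᵒᵖ
    (T.connesCalculus.Form 2) :=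
  Module.Basis.mk hT.linearIndependent_twoForm (by
    rintro x -
    obtain ⟨X, hX, rfl⟩ := exists_formClass x
    obtain ⟨c, rfl⟩ := hT.exists_clifford₂ hX
    rw [formClass_clifford₂ hT]
    exact sum_mem fun p _ => Submodule.smul_mem _ _ (Submodule.subset_span ⟨p, rfl⟩))

theorem twoFormBasis_apply (p : {p : Fin n × Fin n // p.1 < p.2}) :
    hT.twoFormBasis p = hT.twoForm p.1.1 p.1.2 :=
  Module.Basis.mk_apply _ _ p

/-- The differential of a one-form: `d (∑ᵢ eᵢ aᵢ) = ∑_{p < q} eₚ ∧ e_q (∂ₚ a_q - ∂_q aₚ)`. -/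
theorem d_sum_op_smul_oneForm (a : Fin n → B) :
    T.connesCalculus.d (T.connesCalculus.val 1 (∑ i, op (a i) • hT.oneForm i)) =
      T.connesCalculus.val 2 (∑ p : {p : Fin n × Fin n // p.1 < p.2},
        op (der p.1.1 (a p.1.2) - der p.1.2 (a p.1.1)) • hT.twoForm p.1.1 p.1.2) := by
  rw [sum_op_smul_oneForm]
  obtain ⟨ω, hω, hrep⟩ := exists_rep_of_mem_opForms (hT.clifford₁_mem a)
  obtain ⟨a', c, h1, h2, h3⟩ := hT.exists_rep_delta hω
  have ha : a' = a := hT.clifford₁_injective (h1.symm.trans hrep)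
  subst ha
  rw [formClass_congr hrep.symm _ (T.rep_mem hω), d_formClass_rep hω,
    formClass_congr h2 _ (hT.clifford₂_mem c), formClass_clifford₂ hT]
  simp only [h3]

theorem d_oneForm (i : Fin n) : T.connesCalculus.d (T.connesCalculus.val 1 (hT.oneForm i)) = 0 := by
  have h := hT.d_sum_op_smul_oneForm fun j => if j = i then 1 else 0
  have h1 : ∑ j, op (if j = i then (1 : B) else 0) • hT.oneForm j = hT.oneForm i := by
    rw [Finset.sum_eq_single i (fun j _ hj => by rw [if_neg hj, MulOpposite.op_zero, zero_smul])
      (by simp), if_pos rfl, MulOpposite.op_one, one_smul]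
  have h2 : ∀ p j, der p (if j = i then (1 : B) else 0) = 0 := fun p j => by
    split_ifs
    · exact hT.der_one p
    · exact map_zero _
  rw [h1] at h
  rw [h]
  simp [h2]

/-- The coefficient of `eₚ ∧ e_q` in `d (∑ᵢ eᵢ aᵢ)`, computed from `eᵢ aᵢ = aᵢ vᵢ d uᵢ`. -/
theorem sum_der_mul_der {p q : Fin n} (hpq : p ≠ q) (a : Fin n → B) :
    ∑ i, (der p (a i * v i) * der q (u i) - der q (a i * v i) * der p (u i)) =
      der p (a q) - der q (a p) := by
  have h : ∀ {r s : Fin n}, r ≠ s → ∀ x, der r (x * v s) * u s = der r x := fun {r s} hrs x => by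
    rw [hT.der_mul, hT.der_v, if_neg hrs, mul_zero, add_zero, mul_assoc, hT.left_inv, mul_one]
  rw [Finset.sum_sub_distrib]
  congr 1
  · rw [Finset.sum_eq_single q (fun j _ hj => by rw [hT.der_u, if_neg hj.symm, mul_zero])
      (by simp), hT.der_u, if_pos rfl, h hpq]
  · rw [Finset.sum_eq_single p (fun j _ hj => by rw [hT.der_u, if_neg hj.symm, mul_zero])
      (by simp), hT.der_u, if_pos rfl, h hpq.symm]

end IsCliffordType
end DiracTriple

/-! ### The Dirac triple of a C*-algebra generated by isometries -/

section TensorOp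

variable {A : Type*} [CStarAlgebra A] [PartialOrder A] [StarOrderedRing A] {τ : A →ₚ[ℂ] ℂ} {N : ℕ}

theorem tensorOp_mul (X Y : τ.GNS →L[ℂ] τ.GNS) (M M' : Matrix (Fin N) (Fin N) ℂ) :
    tensorOp X M * tensorOp Y M' = tensorOp (X * Y) (M * M') := by
  refine ContinuousLinearMap.ext fun ξ => ?_
  ext j
  change tensorOp X M (tensorOp Y M' ξ) j = _
  simp only [tensorOp_apply, map_sum, map_smul, Matrix.mul_apply, Finset.sum_smul,
    Finset.smul_sum, smul_smul]
  exact Finset.sum_comm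

theorem tensorOp_one_one : tensorOp (1 : τ.GNS →L[ℂ] τ.GNS) (1 : Matrix (Fin N) (Fin N) ℂ) = 1 := by
  refine ContinuousLinearMap.ext fun ξ => ?_
  ext j
  rw [tensorOp_one_apply]
  rfl

theorem tensorOp_neg (X : τ.GNS →L[ℂ] τ.GNS) (M : Matrix (Fin N) (Fin N) ℂ) :
    tensorOp X (-M) = -tensorOp X M := by
  refine ContinuousLinearMap.ext fun ξ => ?_
  ext j
  change _ = -(tensorOp X M ξ j)
  simp [tensorOp_apply]

end TensorOp

/-- Derivations of the `*`-algebra generated by `S` that are diagonal on the generators and their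
adjoints commute, since their commutator is a derivation that vanishes on the generators. -/
theorem derivation_comm_of_generator {A : Type*} [CStarAlgebra A] {n : ℕ} {S : Fin n → A}
    {der : Fin n → (generatedAlgebra S →ₗ[ℂ] generatedAlgebra S)}
    (hder : ∀ i a b, der i (a * b) = der i a * b + a * der i b)
    (hsep : ∀ i j, der i (generator S j) = if i = j then generator S j else 0)
    (hsep_star : ∀ i j,
      der i (star (generator S j)) = if i = j then -star (generator S j) else 0)
    (i j : Fin n) (a : generatedAlgebra S) : der i (der j a) = der j (der i a) := by
  have hmul : ∀ x y, der i (der j x) = der j (der i x) → der i (der j y) = der j (der i y) →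
      der i (der j (x * y)) = der j (der i (x * y)) := fun x y hx hy => by
    simp only [hder, map_add, hx, hy]
    abel
  have hone : ∀ i, der i 1 = 0 := fun i => by simpa using hder i 1 1
  have hscalar : ∀ (i : Fin n) (c : ℂ), der i (algebraMap ℂ _ c) = 0 := fun i c => by
    rw [Algebra.algebraMap_eq_smul_one, map_smul, hone, smul_zero]
  have h : der i (der j a) = der j (der i a) ∧
      der i (der j (star a)) = der j (der i (star a)) := by
    induction a using StarAlgebra.adjoin_induction_subtype with
    | mem x hx =>
      obtain ⟨k, rfl⟩ := hx
      change der i (der j (generator S k)) = der j (der i (generator S k)) ∧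
        der i (der j (star (generator S k))) = der j (der i (star (generator S k)))
      constructor
      · rw [hsep, hsep]
        split_ifs <;> simp [*]
      · rw [hsep_star, hsep_star]
        split_ifs <;> simp [*]
    | algebraMap c =>
      rw [← algebraMap_star_comm]
      simp only [hscalar, map_zero, and_self]
    | add x y hx hy =>
      rw [star_add]
      simp only [map_add, hx.1, hy.1, hx.2, hy.2, and_self]
    | mul x y hx hy =>
      rw [star_mul]
      exact ⟨hmul _ _ hx.1 hy.1, hmul _ _ hy.2 hx.2⟩
    | star x hx =>
      rw [star_star]
      exact hx.symm
  exact h.1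

/-- The Dirac triple is of Clifford type with `Γᵢ = 1 ⊗ γᵢ`, `uᵢ = Sᵢ` and `vᵢ = Sᵢ*`. -/
theorem isCliffordType_diracTriple {A : Type*} [CStarAlgebra A] [PartialOrder A]
    [StarOrderedRing A] {n N : ℕ} [NeZero N] (S : Fin n → A)
    (hS : ∀ i, star (S i) * S i = 1)
    (hgen : (generatedAlgebra S).topologicalClosure = ⊤)
    (der : Fin n → (generatedAlgebra S →ₗ[ℂ] generatedAlgebra S))
    (hder : ∀ i a b, der i (a * b) = der i a * b + a * der i b)
    (hsep : ∀ i j, der i (generator S j) = if i = j then generator S j else 0)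
    (hsep_star : ∀ i j,
      der i (star (generator S j)) = if i = j then -star (generator S j) else 0)
    {τ : A →ₚ[ℂ] ℂ} (hτ : IsFaithfulState τ)
    {γ : Fin n → Matrix (Fin N) (Fin N) ℂ} (hγ : IsGammaFamily γ) :
    (diracTriple (generatedAlgebra S) hgen der hder hτ γ).IsCliffordType der
      (fun i => tensorOp 1 (γ i)) (generator S) (fun i => star (generator S i)) where
  commute i a := by
    change tensorOp 1 (γ i) * tensorOp (τ.gnsStarAlgHom (a : A)) 1 =
      tensorOp (τ.gnsStarAlgHom (a : A)) 1 * tensorOp 1 (γ i)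
    rw [tensorOp_mul, tensorOp_mul, one_mul, mul_one, one_mul, mul_one]
  sq i := by rw [tensorOp_mul, hγ.sq, one_mul, tensorOp_one_one]
  anticomm i j hij := by
    rw [tensorOp_mul, tensorOp_mul, hγ.anticomm i j hij, tensorOp_neg]
  comm_eq a := DiracTriple.comm_unique _ _ _ fun x => by
    obtain ⟨_, x, rfl⟩ := x
    have hsum : ∑ i, (diracTriple (generatedAlgebra S) hgen der hder hτ γ).π (der i a) *
        tensorOp 1 (γ i) = ∑ i, tensorOp (τ.gnsStarAlgHom (der i a : A)) (γ i) :=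
      Finset.sum_congr rfl fun i _ => by
        change tensorOp (τ.gnsStarAlgHom (der i a : A)) 1 * tensorOp 1 (γ i) = _
        rw [tensorOp_mul, one_mul, mul_one]
    rw [hsum]
    refine Eq.trans ?_ (congrArg₂ (· - ·)
      (diracOp_embed _ der hτ γ (fun j => a * x j) _ (spinorRep_embed _ τ N a x)).symm
      (congrArg (spinorRep τ N (a : A)) (diracOp_embed _ der hτ γ x ⟨_, x, rfl⟩ rfl).symm))
    change (∑ i, tensorOp (τ.gnsStarAlgHom (der i a : A)) (γ i))
      (spinorEmbed (generatedAlgebra S) τ N x) = _ - _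
    rw [spinorRep_embed, ← map_sub]
    ext j
    -- the terms `a ∂ᵢ(xₖ)` of the Leibniz rule cancel
    have h : (diracAlg (generatedAlgebra S) der γ (fun j => a * x j) -
        fun j => a * diracAlg (generatedAlgebra S) der γ x j) j =
        ∑ i, ∑ k, γ i j k • (der i a * x k) := by
      simp only [Pi.sub_apply, diracAlg_apply, hder, smul_add, Finset.sum_add_distrib,
        Finset.mul_sum, mul_smul_comm, add_sub_cancel_right]
    rw [spinorEmbed_apply, h]
    simp only [sum_apply, WithLp.ofLp_sum, Finset.sum_apply, tensorOp_apply,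
      spinorEmbed_apply, gns_toGNS]
    simp
  der_mul := hder
  der_comm := derivation_comm_of_generator hder hsep hsep_star
  left_inv i := Subtype.ext (hS i)
  der_u := hsep
  der_v := hsep_star

theorem mainTheorem1 {A : Type*} [CStarAlgebra A] [PartialOrder A] [StarOrderedRing A]
    [Nontrivial A] {n : ℕ} (S : Fin n → A)
    (hS : ∀ i, star (S i) * S i = 1)
    (hgen : (generatedAlgebra S).topologicalClosure = ⊤)
    (der : Fin n → (generatedAlgebra S →ₗ[ℂ] generatedAlgebra S))
    (hder : ∀ i a b, der i (a * b) = der i a * b + a * der i b)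
    (hsep : ∀ i j, der i (generator S j) = if i = j then generator S j else 0)
    (hsep_star : ∀ i j,
      der i (star (generator S j)) = if i = j then -star (generator S j) else 0) :
    (∃ τ : A →ₚ[ℂ] ℂ, IsFaithfulState τ) ∧
    (∃ γ : Fin n → Matrix (Fin (2 ^ (n / 2))) (Fin (2 ^ (n / 2))) ℂ, IsGammaFamily γ) ∧
    ∀ (τ : A →ₚ[ℂ] ℂ) (hτ : IsFaithfulState τ)
      (γ : Fin n → Matrix (Fin (2 ^ (n / 2))) (Fin (2 ^ (n / 2))) ℂ), IsGammaFamily γ →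
      let C := (diracTriple (generatedAlgebra S) hgen der hder hτ γ).connesCalculus
      ∃ (e : Fin n → C.Form 1)
        (P : C.Tensor2 →ₗ[(generatedAlgebra S)ᵐᵒᵖ] C.Tensor2),
        -- the form `e i` is the class of the operator `1 ⊗ γ i`
        (∀ i, ∃ h : tensorOp 1 (γ i) ∈
            (diracTriple (generatedAlgebra S) hgen der hder hτ γ).opForms 1,
          e i = DiracTriple.formClass h) ∧
        -- the calculus is tame
        C.IsTame P ∧
        -- one-forms are free with central basis `e`, and `d (e i) = 0`
        (∃ b : Module.Basis (Fin n) (generatedAlgebra S)ᵐᵒᵖ (C.Form 1), ∀ i, b i = e i) ∧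
        (∀ i, e i ∈ C.center) ∧
        (∀ i, C.d (C.val 1 (e i)) = 0) ∧
        -- two-forms are free with basis `e p ∧ e q`, `p < q`
        (∃ b : Module.Basis {p : Fin n × Fin n // p.1 < p.2} (generatedAlgebra S)ᵐᵒᵖ (C.Form 2),
          ∀ p, b p = C.wedge (DifferentialCalculus.tmul (e p.1.1) (e p.1.2))) ∧
        -- the formula for `d` on one-forms
        (∀ a : Fin n → generatedAlgebra S,
          C.d (C.val 1 (∑ i, MulOpposite.op (a i) • e i)) =
            C.val 2 (∑ p : {p : Fin n × Fin n // p.1 < p.2},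
              MulOpposite.op (∑ i,
                (der p.1.1 (a i * star (generator S i)) * der p.1.2 (generator S i)
                  - der p.1.2 (a i * star (generator S i)) * der p.1.1 (generator S i))) •
              C.wedge (DifferentialCalculus.tmul (e p.1.1) (e p.1.2)))) ∧
        -- the canonical bilinear metric
        (∃ g : C.Tensor2 →ₗ[(generatedAlgebra S)ᵐᵒᵖ] generatedAlgebra S,
          C.IsBilinearMetric P g ∧
          ∀ i j, g (DifferentialCalculus.tmul (e i) (e j)) = if i = j then 1 else 0) := by
  have hsepA : TopologicalSpace.SeparableSpace A :=
    separableSpace_of_topologicalClosure_adjoin_eq_top (Set.finite_range S).countable hgen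
  refine ⟨exists_isFaithfulState, exists_isGammaFamily n, fun τ hτ γ hγ => ?_⟩
  have hT := isCliffordType_diracTriple S hS hgen der hder hsep hsep_star hτ hγ
  have he : ∀ i, hT.oneFormBasis i ∈ DifferentialCalculus.center _ := fun i => by
    rw [hT.oneFormBasis_apply]
    exact hT.oneForm_mem_center i
  refine ⟨hT.oneForm, DifferentialCalculus.symmetrization he, fun i => ⟨hT.generator_mem i, rfl⟩,
    ?_, ⟨hT.oneFormBasis, hT.oneFormBasis_apply⟩, hT.oneForm_mem_center, hT.d_oneForm,
    ⟨hT.twoFormBasis, hT.twoFormBasis_apply⟩, fun a => ?_,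
    ⟨DifferentialCalculus.canonicalMetric he, ?_, fun i j => ?_⟩⟩
  · refine DifferentialCalculus.isTame_symmetrization he hT.twoFormBasis (fun p => ?_)
      fun i j => ?_
    · rw [hT.twoFormBasis_apply, hT.oneFormBasis_apply, hT.oneFormBasis_apply]
      rfl
    · rw [hT.oneFormBasis_apply, hT.oneFormBasis_apply]
      exact hT.twoForm_anticomm i j
  · refine (hT.d_sum_op_smul_oneForm a).trans (congrArg _ (Finset.sum_congr rfl fun p _ => ?_))
    rw [← hT.sum_der_mul_der p.2.ne a]
    rfl
  · exact DifferentialCalculus.isBilinearMetric_canonicalMetric he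
  · rw [← hT.oneFormBasis_apply, ← hT.oneFormBasis_apply]
    exact DifferentialCalculus.canonicalMetric_basis he i j
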